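/- Let $M$ be a Calabi--Yau variety of complex dimension $n$: a compact K\"ahler manifold with $H^1(M,\mathbb C)=0$ and a nowhere vanishing holomorphic volume form $\Omega$. Let $B=\Gamma(\wedge\overline T^*M\otimes\wedge TM)$, bigraded so that $\Gamma(\wedge^q\overline T^*M\otimes\wedge^pTM)$ has bidegree $(p,q)$, with differential $\bar\partial$, its graded commutative product, the operator $\Delta=\bigstar\,\partial\,\bigstar$ ($\bigstar$ denotes contraction with $\Omega$, which identifies $B$ with the complex forms, and its inverse) and the bracket $[x,y]=\Delta(xy)-(\Delta x)y-(-1)^{|x|}x\,\Delta y$. Let $H$ be the cohomology of $B$ and take the Hodge-theoretic transfer data: $\iota:H\to B$ is given by harmonic representatives, $\pi:B\to H$ by orthogonal projection to the harmonic elements, and $h=\bar\partial^*G$ with $G$ the Green operator of the $\bar\partial$-Laplacian (all with respect to the K\"ahler metric on forms, transported to $B$ by $\bigstar$). Let $\mathcal{BV}^{\text{!`}}$ be the Koszul dual cooperad of $\mathcal{BV}$, consisting of sums of trees decorated by the shifted product, bracket and $\Delta$, and let $\mathcal{H}y^{\text{!`}}$ be the quotient of its part without $\Delta$ by the image of the differential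 of $\mathcal{BV}^{\text{!`}}$. For $k\ge 2$, an element $c$ of arity $k$ of $\mathcal{BV}^{\text{!`}}$ without $\Delta$ is a sum of trivalent trees with $k$ leaves decorated by products and brackets; it defines a transferred operation $H^{\otimes k}\to H$, the sum over its trees of the composites in which leaves are decorated by $\iota$, internal edges by $h$, vertices by the product or bracket of $B$, and the root by $\pi$. Let $c$ be homogeneous with exactly $\ell$ brackets in each tree, and assume that it represents a nonzero class of $\mathcal{H}y^{\text{!`}}(k)$. (1) If the class of $c$ is a higher homotopy operation, i.e. lies in the kernel of the canonical map $\mathcal{H}y^{\text{!`}}\to\mathcal{H}y$ (projection to the cogenerators followed by their inclusion as the generators, one for each arity $k\geq 2$), then $0\le\ell<k-2$ and the transferred operation $H^{\otimes k}\to H$ has bidegree $(-\ell,-k+2)$. (2) If the class of $c$ is not in this kernel, so that $c$ represents a (nonzero multiple of the) generating $k$-ary $\mathcal{H}y$ operation of the strict truncation, then the transferred operation has bidegree $(-k+2,-k+2)$. -/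

import Mathlib

open scoped Manifold ContDiff ComplexConjugate ComplexOrder
open MeasureTheory

namespace CYHy

noncomputable section

/-- The unique element with property `P`, and `0` if there is no such unique element. -/
def theUnique {α : Type*} [Zero α] (P : α → Prop) : α :=
  open Classical in if h : ∃! a, P a then h.choose else 0

/-! ## Fibres and calculus -/

/-- The local model `ℂⁿ`. -/
abbrev Cn (n : ℕ) : Type := EuclideanSpace ℂ (Fin n)

/-- Coefficient vectors. For polyvector fields with values in antiholomorphic forms the pair
`(ω, v)` stands for `∑ ωᵢ dz̄ᵢ + ∑ vᵢ ∂/∂zᵢ`; for complex differential forms the pair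
`(ω, α)` stands for `∑ ωᵢ dz̄ᵢ + ∑ αᵢ dzᵢ`. -/
abbrev Coef (n : ℕ) : Type := (Fin n → ℂ) × (Fin n → ℂ)

/-- The fibre, in a holomorphic frame, of `⋀ T̄* ⊗ ⋀ T = ⋀ (T̄* ⊕ T)` and also of
`⋀ T̄* ⊗ ⋀ T* = ⋀ (T̄* ⊕ T*)`, with its graded commutative product. -/
abbrev Fib (n : ℕ) : Type := ExteriorAlgebra ℂ (Coef n)

/-- Linear coordinates on the finite dimensional space `Fib n`. -/
def fibCoord (n : ℕ) :
    Fib n ≃ₗ[ℂ] (Finset (Fin (Module.finrank ℂ (Coef n))) → ℂ) :=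
  (Module.finBasis ℂ (Coef n)).ExteriorAlgebra.equivFun

/-- A norm on the finite dimensional space `Fib n`; it only serves to differentiate functions
with values in `Fib n`, for which all norms are equivalent. -/
instance fibNormed (n : ℕ) : NormedAddCommGroup (Fib n) :=
  NormedAddCommGroup.induced _ _ (fibCoord n).toLinearMap (fibCoord n).injective

instance fibNormedSpace (n : ℕ) : NormedSpace ℂ (Fib n) :=
  NormedSpace.induced ℂ _ _ (fibCoord n).toLinearMap

/-- The generator `dz̄ᵢ`. -/
def dzbar {n : ℕ} (i : Fin n) : Fib n := ExteriorAlgebra.ι ℂ (Pi.single i 1, 0)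

/-- The generator `dzᵢ` (of forms), or `∂/∂zᵢ` (of polyvector fields). -/
def dz {n : ℕ} (i : Fin n) : Fib n := ExteriorAlgebra.ι ℂ (0, Pi.single i 1)

/-- The part of `Fib n` of degree `p` in the generators `∂/∂zᵢ` (or `dzᵢ`) and of degree `q` in
the generators `dz̄ᵢ`; it is zero when `p` or `q` is negative. -/
def bideg (n : ℕ) (p q : ℤ) : Submodule ℂ (Fib n) :=
  if 0 ≤ p ∧ 0 ≤ q then
    (LinearMap.range (ExteriorAlgebra.ι ℂ ∘ₗ LinearMap.inr ℂ (Fin n → ℂ) (Fin n → ℂ))) ^ p.toNat *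
    (LinearMap.range (ExteriorAlgebra.ι ℂ ∘ₗ LinearMap.inl ℂ (Fin n → ℂ) (Fin n → ℂ))) ^ q.toNat
  else ⊥

/-- `∂f/∂zᵢ` at `u`. -/
def wirt {n : ℕ} (i : Fin n) (f : Cn n → Fib n) (u : Cn n) : Fib n :=
  (1 / 2 : ℂ) • (fderiv ℝ f u (EuclideanSpace.single i 1) -
    Complex.I • fderiv ℝ f u (EuclideanSpace.single i Complex.I))

/-- `∂f/∂z̄ᵢ` at `u`. -/
def wirtBar {n : ℕ} (i : Fin n) (f : Cn n → Fib n) (u : Cn n) : Fib n :=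
  (1 / 2 : ℂ) • (fderiv ℝ f u (EuclideanSpace.single i 1) +
    Complex.I • fderiv ℝ f u (EuclideanSpace.single i Complex.I))

/-! ## Sections over a complex manifold

The tangent space at `y` is `ℂⁿ` by means of the preferred chart at `y`, so every (set-theoretic)
section of the bundles above is a function `M → Fib n`. -/

section Manifold

variable {n : ℕ} {M : Type*} [TopologicalSpace M] [ChartedSpace (Cn n) M]
  [IsManifold 𝓘(ℂ, Cn n) ω M]

/-- The holomorphic Jacobian at `y` of the change from the preferred chart at `y` to the one at
`x₀`. -/
def jac (x₀ y : M) : Matrix (Fin n) (Fin n) ℂ :=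
  Matrix.of fun i j => tangentCoordChange 𝓘(ℂ, Cn n) y x₀ y (EuclideanSpace.single j 1) i

/-- The holomorphic Jacobian at `y` of the change from the preferred chart at `x₀` to the one at
`y`. -/
def jacInv (x₀ y : M) : Matrix (Fin n) (Fin n) ℂ :=
  Matrix.of fun i j => tangentCoordChange 𝓘(ℂ, Cn n) x₀ y y (EuclideanSpace.single j 1) i

/-- Change of frame for `T̄* ⊕ T`. -/
def polyTrans (x₀ y : M) : Coef n →ₗ[ℂ] Coef n :=
  LinearMap.prodMap (Matrix.vecMulLinear ((jacInv x₀ y).map conj)) (Matrix.mulVecLin (jac x₀ y))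

/-- Change of frame for `T̄* ⊕ T*`. -/
def formTrans (x₀ y : M) : Coef n →ₗ[ℂ] Coef n :=
  LinearMap.prodMap (Matrix.vecMulLinear ((jacInv x₀ y).map conj))
    (Matrix.vecMulLinear (jacInv x₀ y))

/-- The section `s` written in the coordinates of the preferred chart at `x₀`. -/
def localRep (tr : M → M → (Coef n →ₗ[ℂ] Coef n)) (s : M → Fib n) (x₀ : M) (u : Cn n) : Fib n :=
  ExteriorAlgebra.map (tr x₀ ((extChartAt 𝓘(ℂ, Cn n) x₀).symm u))
    (s ((extChartAt 𝓘(ℂ, Cn n) x₀).symm u))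

/-- The smooth sections. -/
def smoothSections (tr : M → M → (Coef n →ₗ[ℂ] Coef n)) : Submodule ℂ (M → Fib n) where
  carrier := {s | ∀ x₀, ContDiffOn ℝ ∞ (localRep tr s x₀) (extChartAt 𝓘(ℂ, Cn n) x₀).target}
  add_mem' {s t} hs ht x₀ := by
    have h : localRep tr (s + t) x₀ = localRep tr s x₀ + localRep tr t x₀ := by
      funext u; simp [localRep]
    rw [h]
    exact (hs x₀).add (ht x₀)
  zero_mem' x₀ := by
    have h : localRep tr (0 : M → Fib n) x₀ = fun _ => 0 := by
      funext u; simp [localRep]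
    rw [h]
    exact contDiffOn_const
  smul_mem' c s hs x₀ := by
    have h : localRep tr (c • s) x₀ = c • localRep tr s x₀ := by
      funext u; simp [localRep]
    rw [h]
    exact (hs x₀).const_smul c

/-- `∂̄ s = ∑ dz̄ᵢ ∧ ∂s/∂z̄ᵢ`, computed at `x` in the preferred chart at `x`. -/
def dbarOp (tr : M → M → (Coef n →ₗ[ℂ] Coef n)) (s : M → Fib n) (x : M) : Fib n :=
  ∑ i, dzbar i * wirtBar i (localRep tr s x) (extChartAt 𝓘(ℂ, Cn n) x x)

/-- `∂ σ = ∑ dzᵢ ∧ ∂σ/∂zᵢ` for complex differential forms. -/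
def delForm (σ : M → Fib n) (x : M) : Fib n :=
  ∑ i, dz i * wirt i (localRep formTrans σ x) (extChartAt 𝓘(ℂ, Cn n) x x)

/-- The de Rham differential `d = ∂ + ∂̄` of complex differential forms. -/
def dForm (σ : M → Fib n) : M → Fib n := delForm σ + dbarOp formTrans σ

/-- The hermitian matrix field `g`, given in the preferred charts, written in the coordinates of
the preferred chart at `x₀`. -/
def localMetric (g : M → Matrix (Fin n) (Fin n) ℂ) (x₀ : M) (u : Cn n) :
    Matrix (Fin n) (Fin n) ℂ :=
  let y := (extChartAt 𝓘(ℂ, Cn n) x₀).symm u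
  (jacInv x₀ y).transpose * g y * (jacInv x₀ y).map conj

/-- The fundamental form `(i/2) ∑ g_{jk} dz_j ∧ dz̄_k`. -/
def fundamentalForm (g : M → Matrix (Fin n) (Fin n) ℂ) (x : M) : Fib n :=
  (Complex.I / 2) • ∑ j, ∑ k, g x j k • (dz j * dzbar k)

variable (n M) in
/-- The structure of a Calabi-Yau variety on the complex manifold `M` (taken compact and Hausdorff
below): a Kähler metric, a nowhere vanishing holomorphic volume form, and `H¹(M, ℂ) = 0`. -/
structure CalabiYau where
  /-- `metric x` is the matrix `g(∂/∂z_j, ∂/∂z_k)` in the preferred chart at `x`. -/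
  metric : M → Matrix (Fin n) (Fin n) ℂ
  metric_posDef : ∀ x, (metric x).PosDef
  metric_smooth : ∀ x₀ j k, ContDiffOn ℝ ∞ (fun u => localMetric metric x₀ u j k)
    (extChartAt 𝓘(ℂ, Cn n) x₀).target
  metric_kahler : dForm (fundamentalForm metric) = 0
  /-- The holomorphic volume form. -/
  vol : M → Fib n
  vol_mem : ∀ x, vol x ∈ bideg n n 0
  vol_ne_zero : ∀ x, vol x ≠ 0
  vol_holomorphic : ∀ x₀, DifferentiableOn ℂ (localRep formTrans vol x₀)
    (extChartAt 𝓘(ℂ, Cn n) x₀).target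
  /-- Every smooth closed complex `1`-form is exact. -/
  deRham_one : ∀ α ∈ smoothSections (M := M) formTrans,
    (∀ x, α x ∈ LinearMap.range (ExteriorAlgebra.ι ℂ (M := Coef n))) → dForm α = 0 →
    ∃ f : M → ℂ, (fun x => algebraMap ℂ (Fib n) (f x)) ∈ smoothSections (M := M) formTrans ∧
      dForm (fun x => algebraMap ℂ (Fib n) (f x)) = α

/-! ## Pointwise hermitian geometry of forms -/

/-- Contraction of a form with the holomorphic vector `v`. -/
def contr (v : Fin n → ℂ) : Module.End ℂ (Fib n) :=
  CliffordAlgebra.contractLeft (Q := 0)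
    ((Fintype.linearCombination ℂ v) ∘ₗ LinearMap.snd ℂ (Fin n → ℂ) (Fin n → ℂ))

/-- Contraction of a form with the conjugate of the holomorphic vector `v`. -/
def contrBar (v : Fin n → ℂ) : Module.End ℂ (Fib n) :=
  CliffordAlgebra.contractLeft (Q := 0)
    ((Fintype.linearCombination ℂ (fun i => conj (v i))) ∘ₗ
      LinearMap.fst ℂ (Fin n → ℂ) (Fin n → ℂ))

/-- A frame `f₁, …, fₙ` of the holomorphic tangent space orthonormal for the hermitian matrix
`g`. -/
def IsUnitaryFrame (g : Matrix (Fin n) (Fin n) ℂ) (f : Fin n → Fin n → ℂ) : Prop :=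
  ∀ a b, ∑ j, ∑ k, g j k * f a j * conj (f b k) = if a = b then 1 else 0

open scoped MatrixOrder in
theorem exists_unitaryFrame (g : Matrix (Fin n) (Fin n) ℂ) (hg : g.PosDef) :
    ∃ f, IsUnitaryFrame g f := by
  obtain ⟨B, hB⟩ := CStarAlgebra.nonneg_iff_eq_star_mul_self.mp hg.posSemidef.nonneg
  have hdet : IsUnit B.det := by
    have h := hg.det_pos.ne'
    rw [hB, Matrix.det_mul] at h
    exact isUnit_iff_ne_zero.mpr (right_ne_zero_of_mul h)
  rw [Matrix.star_eq_conjTranspose] at hB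
  subst hB
  refine ⟨(B⁻¹).conjTranspose, fun a b => ?_⟩
  have h : (B⁻¹).conjTranspose * (B.conjTranspose * B) * B⁻¹ = 1 := by
    rw [← Matrix.mul_assoc, ← Matrix.conjTranspose_mul, Matrix.mul_nonsing_inv _ hdet,
      Matrix.conjTranspose_one, Matrix.one_mul, Matrix.mul_nonsing_inv _ hdet]
  have h' := congrFun (congrFun h a) b
  rw [Matrix.one_apply] at h'
  rw [← h', Matrix.mul_apply, Finset.sum_comm]
  refine Finset.sum_congr rfl fun k _ => ?_
  rw [Matrix.mul_apply, Finset.sum_mul]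
  refine Finset.sum_congr rfl fun j _ => ?_
  simp only [Matrix.conjTranspose_apply, RCLike.star_def, Complex.conj_conj]
  ring

/-- The component of the form `σ` on the frame vectors `f_I` and the conjugates of `f_J`. -/
def formComp (f : Fin n → Fin n → ℂ) (I J : Finset (Fin n)) (σ : Fib n) : ℂ :=
  ExteriorAlgebra.algebraMapInv
    ((J.sort (· ≤ ·)).foldr (fun j τ => contrBar (f j) τ)
      ((I.sort (· ≤ ·)).foldr (fun i τ => contr (f i) τ) σ))

/-- `T̄* ⊕ T` acting on forms: `T̄*` by exterior multiplication on the left, `T` by contraction. -/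
def polyActionGen (n : ℕ) : Coef n →ₗ[ℂ] Module.End ℂ (Fib n) where
  toFun m := LinearMap.mulLeft ℂ (ExteriorAlgebra.ι ℂ (m.1, (0 : Fin n → ℂ))) + contr m.2
  map_add' m m' := by
    have h1 : ((m + m').1, (0 : Fin n → ℂ)) = (m.1, 0) + (m'.1, 0) := by simp
    have h2 : contr (m + m').2 = contr m.2 + contr m'.2 := by
      have : Fintype.linearCombination ℂ (m + m').2 =
          Fintype.linearCombination ℂ m.2 + Fintype.linearCombination ℂ m'.2 := by
        ext; simp [Fintype.linearCombination_apply, mul_add, Finset.sum_add_distrib]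
      simp only [contr, this, LinearMap.add_comp, map_add]
    rw [h1, h2, map_add]
    refine LinearMap.ext fun x => ?_
    simp only [LinearMap.add_apply, LinearMap.mulLeft_apply, add_mul]
    abel
  map_smul' c m := by
    have h1 : ((c • m).1, (0 : Fin n → ℂ)) = c • (m.1, 0) := by simp
    have h2 : contr (c • m).2 = c • contr m.2 := by
      have : Fintype.linearCombination ℂ (c • m).2 = c • Fintype.linearCombination ℂ m.2 := by
        ext; simp [Fintype.linearCombination_apply, Finset.mul_sum, mul_left_comm]
      simp only [contr, this, LinearMap.smul_comp, map_smul]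
    rw [h1, h2, map_smul]
    refine LinearMap.ext fun x => ?_
    simp only [LinearMap.add_apply, LinearMap.smul_apply, LinearMap.mulLeft_apply,
      smul_mul_assoc, RingHom.id_apply, smul_add]

theorem polyActionGen_sq (n : ℕ) (m : Coef n) : polyActionGen n m * polyActionGen n m = 0 := by
  refine LinearMap.ext fun x => ?_
  have h1 : contr m.2 (ExteriorAlgebra.ι ℂ (m.1, (0 : Fin n → ℂ)) * x) =
      -(ExteriorAlgebra.ι ℂ (m.1, (0 : Fin n → ℂ)) * contr m.2 x) := by
    have := CliffordAlgebra.contractLeft_ι_mul (Q := (0 : QuadraticForm ℂ (Coef n)))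
      (d := (Fintype.linearCombination ℂ m.2) ∘ₗ LinearMap.snd ℂ (Fin n → ℂ) (Fin n → ℂ))
      (m.1, (0 : Fin n → ℂ)) x
    simpa [contr, ExteriorAlgebra.ι] using this
  have h2 : contr m.2 (contr m.2 x) = 0 := CliffordAlgebra.contractLeft_contractLeft _ x
  simp only [polyActionGen, LinearMap.coe_mk, AddHom.coe_mk, Module.End.mul_apply,
    LinearMap.add_apply, LinearMap.mulLeft_apply, mul_add, h1, h2, ← mul_assoc,
    ExteriorAlgebra.ι_sq_zero, zero_mul, LinearMap.zero_apply]
  abel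

/-- The action of `⋀ (T̄* ⊕ T)` on forms. -/
def polyAction (n : ℕ) : Fib n →ₐ[ℂ] Module.End ℂ (Fib n) :=
  ExteriorAlgebra.lift ℂ ⟨polyActionGen n, polyActionGen_sq n⟩

/-! ## The complex `B` and its cohomology `H` -/

variable (n M) in
/-- `B = Γ(⋀ T̄* ⊗ ⋀ T)`, inside the algebra of all set-theoretic sections. -/
abbrev B : Submodule ℂ (M → Fib n) := smoothSections polyTrans

/-- The differential of `B`. -/
def dbar (s : M → Fib n) : M → Fib n := dbarOp polyTrans s

theorem differentiableAt_localRep {s : M → Fib n} (hs : s ∈ B n M) (x : M) :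
    DifferentiableAt ℝ (localRep polyTrans s x) (extChartAt 𝓘(ℂ, Cn n) x x) :=
  ((hs x).contDiffAt (extChartAt_target_mem_nhds x)).differentiableAt (by simp)

variable (n M) in
/-- The differential of `B` as a linear map. -/
def dbarLin : B n M →ₗ[ℂ] (M → Fib n) where
  toFun s := dbar s.1
  map_add' s t := by
    funext x
    have h : localRep polyTrans (s.1 + t.1) x =
        localRep polyTrans s.1 x + localRep polyTrans t.1 x := by
      funext u; simp [localRep]
    simp only [dbar, dbarOp, Pi.add_apply, Submodule.coe_add, h, wirtBar,
      fderiv_add (differentiableAt_localRep s.2 x) (differentiableAt_localRep t.2 x),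
      add_apply, ← Finset.sum_add_distrib]
    refine Finset.sum_congr rfl fun i _ => ?_
    rw [← mul_add, ← smul_add, smul_add Complex.I]
    congr 2
    abel
  map_smul' c s := by
    funext x
    have h : localRep polyTrans (c • s.1) x = c • localRep polyTrans s.1 x := by
      funext u; simp [localRep]
    simp only [dbar, dbarOp, Pi.smul_apply, Submodule.coe_smul, h, wirtBar, RingHom.id_apply,
      fderiv_const_smul (differentiableAt_localRep s.2 x) c, smul_apply,
      Finset.smul_sum]
    refine Finset.sum_congr rfl fun i _ => ?_
    rw [smul_comm Complex.I c, ← smul_add, smul_comm (1 / 2 : ℂ) c, mul_smul_comm]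

variable (n M) in
/-- The cocycles. -/
def cocycles : Submodule ℂ (M → Fib n) := (LinearMap.ker (dbarLin n M)).map (B n M).subtype

variable (n M) in
/-- The cohomology of `B`: cocycles modulo coboundaries. -/
abbrev H : Type _ := cocycles n M ⧸ (LinearMap.range (dbarLin n M)).submoduleOf (cocycles n M)

/-- The class of a section, and `0` if it is not a smooth cocycle. -/
def cls (s : M → Fib n) : H n M :=
  open Classical in
  if h : s ∈ cocycles n M then Submodule.Quotient.mk ⟨s, h⟩ else 0

/-- The classes in `H` of bidegree `(p, q)`: polyvector degree `p`, and degree `q` in `dz̄`. -/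
def cohBideg (p q : ℤ) : Submodule ℂ (H n M) :=
  (Submodule.comap (cocycles n M).subtype (Submodule.pi Set.univ fun _ => bideg n p q)).map
    (Submodule.mkQ _)

/-- The map `F : H^{⊗k} → H`, written as a function of `k` arguments, has bidegree `(a, b)`. -/
def HasBidegree {k : ℕ} (F : (Fin k → H n M) → H n M) (a b : ℤ) : Prop :=
  ∀ (p q : Fin k → ℤ) (x : Fin k → H n M), (∀ i, x i ∈ cohBideg (p i) (q i)) →
    F x ∈ cohBideg ((∑ i, p i) + a) ((∑ i, q i) + b)

/-! ## The Batalin-Vilkovisky structure -/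

namespace CalabiYau

variable (X : CalabiYau n M)

/-- Contraction with the holomorphic volume form, from `⋀ (T̄* ⊕ T)` to forms. -/
def bigstar (x : M) (s : Fib n) : Fib n := polyAction n s (X.vol x)

/-- The inverse of `bigstar`. -/
def bigstarInv (x : M) (σ : Fib n) : Fib n := theUnique fun s => X.bigstar x s = σ

/-- The operator `Δ = ★ ∂ ★`. -/
def bv (s : M → Fib n) (x : M) : Fib n :=
  X.bigstarInv x (delForm (fun y => X.bigstar y (s y)) x)

end CalabiYau

/-- The parity involution, `(-1)^{|s|} s` on homogeneous `s`. -/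
def par (s : M → Fib n) : M → Fib n := fun x => CliffordAlgebra.involute (s x)

namespace CalabiYau

variable (X : CalabiYau n M)

/-- The bracket `Δ(st) - (Δs)t - (-1)^{|s|} s Δt`. -/
def bracket (s t : M → Fib n) : M → Fib n :=
  X.bv (s * t) - X.bv s * t - par s * X.bv t

/-! ## Hodge theory and the transfer data

Contraction with the volume form is an isomorphism of complexes from `B` to the complex forms with
`∂̄`, so the Hodge theory of forms is expressed on `B`. On a compact manifold the elements
described below exist and are unique for smooth arguments. -/

variable [MeasurableSpace M]

/-- The Riemannian volume measure of the metric: in each chart it is `det g` times Lebesgue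
measure. These local measures agree on overlaps, and the supremum glues them. -/
def volume : Measure M :=
  ⨆ x₀ : M, Measure.map (extChartAt 𝓘(ℂ, Cn n) x₀).symm
    (((MeasureTheory.volume : Measure (Cn n)).restrict
      (extChartAt 𝓘(ℂ, Cn n) x₀).target).withDensity
        fun u => ENNReal.ofReal (localMetric X.metric x₀ u).det.re)

/-- A unitary frame at `x`. -/
def frame (x : M) : Fin n → Fin n → ℂ :=
  (exists_unitaryFrame (X.metric x) (X.metric_posDef x)).choose

/-- The hermitian inner product of forms at `x` induced by the metric. -/
def formInner (x : M) (σ τ : Fib n) : ℂ :=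
  ∑ I : Finset (Fin n), ∑ J : Finset (Fin n),
    formComp (X.frame x) I J σ * conj (formComp (X.frame x) I J τ)

/-- The global inner product of forms, transported to `B` by contraction with the volume form. -/
def inner (s t : M → Fib n) : ℂ :=
  ∫ x, X.formInner x (X.bigstar x (s x)) (X.bigstar x (t x)) ∂X.volume

/-- The formal adjoint of `∂̄`. -/
def dbarAdj (s : M → Fib n) : M → Fib n :=
  theUnique fun t => t ∈ B n M ∧ ∀ r ∈ B n M, X.inner (dbar r) s = X.inner r t

/-- The `∂̄`-Laplacian. -/
def laplacian (s : M → Fib n) : M → Fib n := dbar (X.dbarAdj s) + X.dbarAdj (dbar s)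

/-- Harmonic elements of `B`. -/
def IsHarmonic (s : M → Fib n) : Prop := s ∈ cocycles n M ∧ X.dbarAdj s = 0

/-- The orthogonal projection to the harmonic elements. -/
def harmProj (s : M → Fib n) : M → Fib n :=
  theUnique fun a => X.IsHarmonic a ∧ ∀ r, X.IsHarmonic r → X.inner a r = X.inner s r

/-- The Green operator: the inverse of the Laplacian on the orthogonal complement of the harmonic
elements, extended by zero to the harmonic elements. -/
def green (s : M → Fib n) : M → Fib n :=
  theUnique fun y => y ∈ B n M ∧ (∀ r, X.IsHarmonic r → X.inner y r = 0) ∧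
    X.laplacian y = s - X.harmProj s

/-- The inclusion `H → B` by harmonic representatives. -/
def incl (c : H n M) : M → Fib n := theUnique fun a => X.IsHarmonic a ∧ cls a = c

/-- The projection `B → H`. -/
def proj (s : M → Fib n) : H n M := cls (X.harmProj s)

/-- The homotopy `∂̄* G`. -/
def htpy (s : M → Fib n) : M → Fib n := X.dbarAdj (X.green s)

end CalabiYau

/-! ## Trees and the Koszul dual cooperads

The generators of the operad `BV` are the commutative product (degree `0`), the bracket and the
operator `Δ` (degree `-1`, both odd), where the product and the bracket are symmetric. In the cofree
cooperad on the shifted generators a product vertex is odd, whereas bracket and `Δ` vertices are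
even; the vertices of a planar tree are ordered with the root first, then the left subtree, then
the right subtree. -/

/-- Decorations of binary vertices. -/
inductive Dec : Type
  | prod
  | brk
  deriving DecidableEq

/-- Planar trees with binary vertices decorated by the product or the bracket, with unary vertices
decorated by `Δ`, and with leaves labelled by `α`. -/
inductive Tree (α : Type) : Type
  | leaf (a : α) : Tree α
  | delta (t : Tree α) : Tree α
  | node (d : Dec) (l r : Tree α) : Tree α

namespace Tree

variable {α : Type}

/-- The labels of the leaves, from left to right. -/
def leaves : Tree α → List α
  | leaf a => [a]
  | delta t => t.leaves
  | node _ l r => l.leaves ++ r.leaves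

/-- The number of vertices decorated by the product. -/
def prods : Tree α → ℕ
  | leaf _ => 0
  | delta t => t.prods
  | node d l r => (if d = Dec.prod then 1 else 0) + l.prods + r.prods

/-- The number of vertices decorated by the bracket. -/
def brks : Tree α → ℕ
  | leaf _ => 0
  | delta t => t.brks
  | node d l r => (if d = Dec.brk then 1 else 0) + l.brks + r.brks

/-- The number of vertices decorated by `Δ`. -/
def deltas : Tree α → ℕ
  | leaf _ => 0
  | delta t => t.deltas + 1
  | node _ l r => l.deltas + r.deltas

end Tree

/-- Planar trees with one leaf replaced by a hole. -/
inductive Ctx (α : Type) : Type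
  | hole : Ctx α
  | delta (K : Ctx α) : Ctx α
  | left (d : Dec) (K : Ctx α) (r : Tree α) : Ctx α
  | right (d : Dec) (l : Tree α) (K : Ctx α) : Ctx α

/-- Grafting a tree into the hole. -/
def Ctx.plug {α : Type} : Ctx α → Tree α → Tree α
  | hole, t => t
  | delta K, t => Tree.delta (K.plug t)
  | left d K r, t => Tree.node d (K.plug t) r
  | right d l K, t => Tree.node d l (K.plug t)

/-- The coefficient, in the cofree cooperad element `c`, of the tree obtained by grafting
`a (b (T₁, T₂), T₃)` into `K`. -/
def cubic {α : Type} (c : Tree α → ℂ) (K : Ctx α) (a b : Dec) (T₁ T₂ T₃ : Tree α) : ℂ :=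
  c (K.plug (.node a (.node b T₁ T₂) T₃))

/-- The sign of moving `T₁` past `T₂` and `T₃`. -/
def cycSign {α : Type} (T₁ T₂ T₃ : Tree α) : ℂ := (-1) ^ (T₁.prods * (T₂.prods + T₃.prods))

/-- An element of arity `k` of the cofree cooperad on the shifted generators is given by its
coefficients `c T` on the planar trees `T`, equivariantly under exchange of the two subtrees at a
vertex. It belongs to the Koszul dual cooperad `BV^¡` if at every pair of adjacent vertices it lies
in the space of (doubly shifted) quadratic relations of `BV`: commutativity and associativity of
the product, the Jacobi identity, the Leibniz rule, `Δ² = 0`, `Δ` is a derivation of the bracket,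
and the quadratic part `Δ(xy) - (Δx)y ∓ x(Δy)` of the definition of the bracket. -/
structure IsKoszulDual {k : ℕ} (c : Tree (Fin k) → ℂ) : Prop where
  labels : ∀ T, c T ≠ 0 → T.leaves.Perm (List.finRange k)
  swap : ∀ K d T₁ T₂, c (Ctx.plug K (.node d T₁ T₂)) =
    (-1) ^ (T₁.prods * T₂.prods) * c (Ctx.plug K (.node d T₂ T₁))
  /-- The span of `(xy)z - (yz)x` and `(yz)x - (zx)y`. -/
  assoc : ∀ K T₁ T₂ T₃, cubic c K .prod .prod T₁ T₂ T₃ +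
    cycSign T₁ T₂ T₃ * cubic c K .prod .prod T₂ T₃ T₁ +
    cycSign T₃ T₁ T₂ * cubic c K .prod .prod T₃ T₁ T₂ = 0
  /-- The span of `[[x,y],z] + [[y,z],x] + [[z,x],y]`. -/
  jacobi : ∀ K T₁ T₂ T₃, cubic c K .brk .brk T₁ T₂ T₃ =
    cycSign T₁ T₂ T₃ * cubic c K .brk .brk T₂ T₃ T₁
  /-- The span of the `[xy,z] - [y,z]x - [z,x]y`; the double shift turns the minus signs into plus
  signs. -/
  leibniz : ∀ K T₁ T₂ T₃, cubic c K .prod .brk T₁ T₂ T₃ =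
    cycSign T₁ T₂ T₃ * cubic c K .brk .prod T₂ T₃ T₁ +
    cycSign T₃ T₁ T₂ * cubic c K .brk .prod T₃ T₁ T₂
  /-- The span of `Δ(xy) - (Δx)y - x(Δy)` and of `Δ[x,y] + [Δx,y] + [x,Δy]`; the double shift
  makes all signs equal. -/
  delta_left : ∀ K d T₁ T₂, c (Ctx.plug K (.delta (.node d T₁ T₂))) =
    c (Ctx.plug K (.node d (.delta T₁) T₂))
  delta_right : ∀ K d T₁ T₂, c (Ctx.plug K (.delta (.node d T₁ T₂))) =
    c (Ctx.plug K (.node d T₁ (.delta T₂)))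

/-- The arity `k` part of `BV^¡` (of its completion with respect to the number of `Δ`, but only
homogeneous elements are used). -/
def BVco (k : ℕ) : Submodule ℂ (Tree (Fin k) → ℂ) where
  carrier := {c | IsKoszulDual c}
  zero_mem' := by constructor <;> simp [cubic]
  add_mem' {c c'} h h' :=
    { labels := fun T hT => by
        by_cases h0 : c T = 0
        · exact h'.labels T fun h1 => hT (by simp [h0, h1])
        · exact h.labels T h0
      swap := fun K d T₁ T₂ => by
        simp only [Pi.add_apply]; rw [h.swap, h'.swap]; ring
      assoc := fun K T₁ T₂ T₃ => by
        have e := h.assoc K T₁ T₂ T₃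
        have e' := h'.assoc K T₁ T₂ T₃
        simp only [cubic, Pi.add_apply] at *
        linear_combination e + e'
      jacobi := fun K T₁ T₂ T₃ => by
        have e := h.jacobi K T₁ T₂ T₃
        have e' := h'.jacobi K T₁ T₂ T₃
        simp only [cubic, Pi.add_apply] at *
        linear_combination e + e'
      leibniz := fun K T₁ T₂ T₃ => by
        have e := h.leibniz K T₁ T₂ T₃
        have e' := h'.leibniz K T₁ T₂ T₃
        simp only [cubic, Pi.add_apply] at *
        linear_combination e + e'
      delta_left := fun K d T₁ T₂ => by
        simp only [Pi.add_apply]; rw [h.delta_left, h'.delta_left]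
      delta_right := fun K d T₁ T₂ => by
        simp only [Pi.add_apply]; rw [h.delta_right, h'.delta_right] }
  smul_mem' z c h :=
    { labels := fun T hT => h.labels T fun h1 => hT (by simp [h1])
      swap := fun K d T₁ T₂ => by
        simp only [Pi.smul_apply, smul_eq_mul]; rw [h.swap]; ring
      assoc := fun K T₁ T₂ T₃ => by
        have e := h.assoc K T₁ T₂ T₃
        simp only [cubic, Pi.smul_apply, smul_eq_mul] at *
        linear_combination z * e
      jacobi := fun K T₁ T₂ T₃ => by
        have e := h.jacobi K T₁ T₂ T₃
        simp only [cubic, Pi.smul_apply, smul_eq_mul] at *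
        linear_combination z * e
      leibniz := fun K T₁ T₂ T₃ => by
        have e := h.leibniz K T₁ T₂ T₃
        simp only [cubic, Pi.smul_apply, smul_eq_mul] at *
        linear_combination z * e
      delta_left := fun K d T₁ T₂ => by
        simp only [Pi.smul_apply]; rw [h.delta_left]
      delta_right := fun K d T₁ T₂ => by
        simp only [Pi.smul_apply]; rw [h.delta_right] }

/-- The part of `BV^¡` of arity `k` in which the operator `Δ` appears `m` times. -/
def BVcoDelta (k m : ℕ) : Submodule ℂ (Tree (Fin k) → ℂ) :=
  BVco k ⊓
  { carrier := {c | ∀ T, T.deltas ≠ m → c T = 0}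
    zero_mem' := fun _ _ => rfl
    add_mem' := fun h h' T hT => by simp [h T hT, h' T hT]
    smul_mem' := fun z c h T hT => by simp [h T hT] }

/-- The differential of `BV^¡` contracts a vertex `Δ` together with a product vertex whose output
is the input of that `Δ` to one bracket vertex, in all possible ways. The coefficient of the result at a tree `T`
is therefore the signed sum, over the bracket vertices of `T`, of the coefficients at the trees in
which that vertex has been replaced by `Δ` applied to the product. -/
def diffCoeff {α : Type} : Tree α → (Tree α → ℂ) → ℂ
  | .leaf _, _ => 0
  | .delta t, c => diffCoeff t fun t' => c (.delta t')
  | .node d l r, c =>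
      (if d = Dec.brk then c (.delta (.node .prod l r)) else 0) +
      (if d = Dec.prod then -1 else 1) *
        (diffCoeff l (fun l' => c (.node d l' r)) +
          (-1) ^ l.prods * diffCoeff r (fun r' => c (.node d l r')))

theorem diffCoeff_add {α : Type} (T : Tree α) (c c' : Tree α → ℂ) :
    diffCoeff T (fun t => c t + c' t) = diffCoeff T c + diffCoeff T c' := by
  induction T generalizing c c' with
  | leaf a => simp [diffCoeff]
  | delta t ih => simp only [diffCoeff]; exact ih _ _
  | node d l r ihl ihr =>
    simp only [diffCoeff]
    rw [ihl, ihr]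
    split_ifs <;> ring

theorem diffCoeff_smul {α : Type} (T : Tree α) (z : ℂ) (c : Tree α → ℂ) :
    diffCoeff T (fun t => z * c t) = z * diffCoeff T c := by
  induction T generalizing c with
  | leaf a => simp [diffCoeff]
  | delta t ih => simp only [diffCoeff]; exact ih _
  | node d l r ihl ihr =>
    simp only [diffCoeff]
    rw [ihl, ihr]
    split_ifs <;> ring

/-- The differential of `BV^¡`. -/
def diff (k : ℕ) : (Tree (Fin k) → ℂ) →ₗ[ℂ] (Tree (Fin k) → ℂ) where
  toFun c T := diffCoeff T c
  map_add' c c' := funext fun T => diffCoeff_add T c c'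
  map_smul' z c := funext fun T => diffCoeff_smul T z c

/-- The image of the differential in the part without `Δ`. -/
def boundaries (k : ℕ) : Submodule ℂ (BVcoDelta k 0) :=
  ((BVcoDelta k 1).map (diff k)).submoduleOf (BVcoDelta k 0)

/-- The arity `k` part of the Koszul dual cooperad `Hy^¡`: the part of `BV^¡` without `Δ`, modulo
the image of the differential. -/
abbrev HyCo (k : ℕ) : Type := BVcoDelta k 0 ⧸ boundaries k

/-- The tree `[…[[i j, a₁], a₂], …]` with `a₁ < a₂ < …` the labels other than `i` and `j`. -/
def pairTree {k : ℕ} (i j : Fin k) : Tree (Fin k) :=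
  ((List.finRange k).filter fun a => a ≠ i ∧ a ≠ j).foldl
    (fun t a => .node .brk t (.leaf a)) (.node .prod (.leaf i) (.leaf j))

/-- The operad `Hy` has one generator `m_k` in each arity `k ≥ 2`. The projection of `Hy^¡` to its
cogenerators is dual to the inclusion of the generators
`{a₁, …, a_k} = ∑_{i<j} ± {aᵢ, aⱼ} a₁ ⋯ âᵢ ⋯ âⱼ ⋯ a_k` of the gravity operad, where the
Gerstenhaber operad is dual to the part of `BV^¡` without `Δ` and Koszul duality exchanges product
and bracket. This is the coefficient of (the shift of) `m_k`, on representatives. -/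
def cogen (k : ℕ) : BVcoDelta k 0 →ₗ[ℂ] ℂ :=
  (∑ i : Fin k, ∑ j ∈ Finset.Ioi i,
    (LinearMap.proj (pairTree i j) : (Tree (Fin k) → ℂ) →ₗ[ℂ] ℂ)) ∘ₗ (BVcoDelta k 0).subtype

/-- The higher homotopy operations: the kernel of `Hy^¡ → Hy`. -/
def higherOps (k : ℕ) : Submodule ℂ (HyCo k) :=
  (LinearMap.ker (cogen k)).map (boundaries k).mkQ

/-- All trees that occur in `c` have exactly `ℓ` brackets. -/
def HomogeneousBrackets {k : ℕ} (c : BVcoDelta k 0) (ℓ : ℕ) : Prop :=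
  ∀ T, c.1 T ≠ 0 → T.brks = ℓ

/-! ## The transferred operations -/

/-- The Koszul sign of rearranging homogeneous inputs of parities `ε` in the order `l`. -/
def koszulSign {k : ℕ} (ε : Fin k → Fin 2) : List (Fin k) → ℂ
  | [] => 1
  | a :: l => (l.map fun b => if b < a then (-1 : ℂ) ^ ((ε a : ℕ) * (ε b : ℕ)) else 1).prod *
      koszulSign ε l

/-- The even (`e = 0`) and odd (`e = 1`) part of a section. -/
def parityPart (e : Fin 2) (s : M → Fib n) : M → Fib n :=
  (1 / 2 : ℂ) • (s + (-1 : ℂ) ^ (e : ℕ) • par s)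

namespace CalabiYau

variable (X : CalabiYau n M) [MeasurableSpace M]

/-- The operation of `B` given by a binary vertex. -/
def binary : Dec → (M → Fib n) → (M → Fib n) → (M → Fib n)
  | .prod, s, t => s * t
  | .brk, s, t => X.bracket s t

/-- The value carried by the edge below the tree `T`, when its leaves carry `x`: internal edges are
decorated by the homotopy, leaves are not. The signs are the Koszul signs for composing the
operations `h ∘ (vertex)`, whose parity is that of the number of product vertices. -/
def edgeVal {k : ℕ} (x : Fin k → M → Fib n) : Tree (Fin k) → (M → Fib n)
  | .leaf i => x i
  | .delta t => X.htpy (X.bv (edgeVal x t))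
  | .node d l r => X.htpy ((-1 : ℂ) ^ (l.prods * r.prods) •
      X.binary d (par^[r.prods] (edgeVal x l)) (edgeVal x r))

/-- The value at the root vertex of the tree `T`, before projecting to `H`. -/
def rootVal {k : ℕ} (x : Fin k → M → Fib n) : Tree (Fin k) → (M → Fib n)
  | .leaf i => x i
  | .delta t => X.bv (X.edgeVal x t)
  | .node d l r => (-1 : ℂ) ^ (l.prods * r.prods) •
      X.binary d (par^[r.prods] (X.edgeVal x l)) (X.edgeVal x r)

/-- The operation `H^{⊗k} → H` given by the decorated tree `T`. -/
def treeOp {k : ℕ} (T : Tree (Fin k)) (x : Fin k → H n M) : H n M :=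
  ∑ ε : Fin k → Fin 2, koszulSign ε T.leaves •
    X.proj (X.rootVal (fun i => parityPart (ε i) (X.incl (x i))) T)

/-- The transferred operation `H^{⊗k} → H` of an element `c` of `BV^¡` without `Δ`: the sum of the
operations of the trees in `c`. Each tree has `2^{k-1}` planar representatives. -/
def transferredOp {k : ℕ} (c : BVcoDelta k 0) (x : Fin k → H n M) : H n M :=
  (1 / 2 : ℂ) ^ (k - 1) • ∑ᶠ T : Tree (Fin k), c.1 T • X.treeOp T x

end CalabiYau

end Manifold

end

end CYHy

/-!
For the bounds on `ℓ`, the point is that the parts of `BV^¡` without products, and with exactly one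
product and vanishing cogenerator coefficient, are exact. On them a coefficient function is a linear
functional of the vertex form of a tree, the exterior product over its product vertices of the sums
of `e i j` with `i` above the left and `j` above the right input. In these terms the Koszul dual
relations are the identities of an exterior algebra, and the differential multiplies by the sum of
all `e i j`. A functional vanishing on the multiples of that sum is a boundary, because contraction
is a homotopy for multiplication. Conversely, the differential replaces brackets by products one at
a time, with signs, and doing this twice gives zero, so the cogenerator coefficient vanishes on
boundaries.

For the bidegrees, let the torus `Circle × Circle` rescale the coordinate forms `dz` and `dz̄`.
The elements of bidegree `(p, q)` are its weight vectors for the character `a ^ p * b ^ q`. The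
metrics are invariant, so all operators of the transfer data are equivariant up to a character: the
product, `ι` and `π` have weight `(0, 0)`, `Δ` and the bracket `(-1, 0)`, and `h` has `(0, -1)`. A
tree with `k` leaves has `k - 1` vertices and `k - 2` internal edges.
-/

namespace CYHy

noncomputable section

/-! ## Polarization of trees -/

section Polar

variable {α : Type} {A A' : Type*} [AddCommGroup A] [Module ℂ A] [AddCommGroup A'] [Module ℂ A']

/-- The signed sum, over the bracket vertices of a tree, of the values of a function of trees at
the tree in which that bracket has been replaced by a product. The differential `diffCoeff` takes
this form as soon as `Δ` can be moved to the root. -/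
def polar : Tree α → (Tree α → A) →ₗ[ℂ] A
  | .leaf _ => 0
  | .delta t => polar t ∘ₗ LinearMap.funLeft ℂ A .delta
  | .node .prod l r =>
      -(polar l ∘ₗ LinearMap.funLeft ℂ A (.node .prod · r) +
        (-1 : ℂ) ^ l.prods • polar r ∘ₗ LinearMap.funLeft ℂ A (.node .prod l))
  | .node .brk l r =>
      LinearMap.proj (.node .prod l r) + polar l ∘ₗ LinearMap.funLeft ℂ A (.node .brk · r) +
        (-1 : ℂ) ^ l.prods • polar r ∘ₗ LinearMap.funLeft ℂ A (.node .brk l)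

theorem polar_leaf (a : α) (c : Tree α → A) : polar (.leaf a) c = 0 := rfl

theorem polar_node_prod (l r : Tree α) (c : Tree α → A) :
    polar (.node .prod l r) c = -(polar l (fun l' => c (.node .prod l' r)) +
      (-1 : ℂ) ^ l.prods • polar r fun r' => c (.node .prod l r')) := rfl

theorem polar_node_brk (l r : Tree α) (c : Tree α → A) :
    polar (.node .brk l r) c = c (.node .prod l r) + polar l (fun l' => c (.node .brk l' r)) +
      (-1 : ℂ) ^ l.prods • polar r fun r' => c (.node .brk l r') := rfl

theorem polar_zero (T : Tree α) : polar T (fun _ => (0 : A)) = 0 := map_zero (polar T)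

theorem polar_neg (T : Tree α) (c : Tree α → A) : polar T (fun t => -c t) = -polar T c :=
  map_neg (polar T) c

theorem polar_add (T : Tree α) (c c' : Tree α → A) :
    polar T (fun t => c t + c' t) = polar T c + polar T c' := map_add (polar T) c c'

theorem polar_smul (T : Tree α) (z : ℂ) (c : Tree α → A) :
    polar T (fun t => z • c t) = z • polar T c := map_smul (polar T) z c

theorem map_polar (f : A →ₗ[ℂ] A') (T : Tree α) (c : Tree α → A) :
    f (polar T c) = polar T fun t => f (c t) := by
  induction T generalizing c with
  | leaf => exact map_zero f
  | delta _ ih => exact ih _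
  | node d l r ihl ihr => cases d <;> simp [polar_node_prod, polar_node_brk, ihl, ihr]

theorem polar_congr (T : Tree α) {c c' : Tree α → A}
    (h : ∀ T' : Tree α, T'.leaves = T.leaves → T'.prods = T.prods + 1 → T'.deltas = T.deltas →
      c T' = c' T') : polar T c = polar T c' := by
  induction T generalizing c c' with
  | leaf a => rfl
  | delta t ih => exact ih fun T' h₁ h₂ h₃ => h _ h₁ h₂ (congrArg (· + 1) h₃)
  | node d l r ihl ihr =>
    have hl := ihl (c := fun l' => c (.node d l' r)) (c' := fun l' => c' (.node d l' r))
      fun T' h₁ h₂ h₃ => h _ (by simp [Tree.leaves, h₁]) (by simp only [Tree.prods, h₂]; ring)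
        (by simp [Tree.deltas, h₃])
    have hr := ihr (c := fun r' => c (.node d l r')) (c' := fun r' => c' (.node d l r'))
      fun T' h₁ h₂ h₃ => h _ (by simp [Tree.leaves, h₁]) (by simp only [Tree.prods, h₂]; ring)
        (by simp [Tree.deltas, h₃])
    cases d
    · rw [polar_node_prod, polar_node_prod, hl, hr]
    · rw [polar_node_brk, polar_node_brk, hl, hr,
        h (.node .prod l r) (by simp [Tree.leaves]) (by simp [Tree.prods]; ring)
          (by simp [Tree.deltas])]

theorem polar_sign_smul (T : Tree α) (c : Tree α → A) :
    polar T (fun t => (-1 : ℂ) ^ t.prods • c t) = -((-1 : ℂ) ^ T.prods • polar T c) := by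
  rw [polar_congr T (c' := fun t => (-1 : ℂ) ^ (T.prods + 1) • c t) fun t _ h _ => by rw [h],
    polar_smul, pow_succ, mul_neg_one, neg_smul]

theorem polar_comm (S T : Tree α) (c : Tree α → Tree α → A) :
    polar S (fun s => polar T fun t => c s t) = polar T fun t => polar S fun s => c s t := by
  induction S generalizing c with
  | leaf => exact (polar_zero T).symm
  | delta _ ih => exact ih fun s t => c s.delta t
  | node d l r ihl ihr =>
    cases d <;>
      simp only [polar_node_prod, polar_node_brk, polar_neg, polar_add, polar_smul,
        ihl fun l' t => c (.node _ l' r) t, ihr fun r' t => c (.node _ l r') t]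

theorem polar_polar (T : Tree α) (c : Tree α → A) : polar T (fun T' => polar T' c) = 0 := by
  induction T generalizing c with
  | leaf a => rfl
  | delta _ ih => exact ih _
  | node d l r ihl ihr =>
    cases d <;>
    · simp only [polar_node_prod, polar_node_brk, polar_neg, polar_add, polar_smul,
        polar_sign_smul, ihl, ihr]
      rw [polar_comm r l]
      module

theorem diffCoeff_congr (T : Tree α) {c c' : Tree α → ℂ}
    (h : ∀ T' : Tree α, T'.leaves = T.leaves → T'.deltas = T.deltas + 1 → c T' = c' T') :
    diffCoeff T c = diffCoeff T c' := by
  induction T generalizing c c' with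
  | leaf a => rfl
  | delta t ih => exact ih fun T' h₁ h₂ => h _ h₁ (congrArg (· + 1) h₂)
  | node d l r ihl ihr =>
    simp only [diffCoeff]
    rw [ihl (c' := fun l' => c' (.node d l' r)), ihr (c' := fun r' => c' (.node d l r')),
      h (.delta (.node .prod l r)) rfl rfl]
    · exact fun T' h₁ h₂ => h _ (by simp [Tree.leaves, h₁]) (by simp [Tree.deltas, h₂]; ring)
    · exact fun T' h₁ h₂ => h _ (by simp [Tree.leaves, h₁]) (by simp [Tree.deltas, h₂]; ring)

theorem diffCoeff_eq_polar {y : Tree α → ℂ}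
    (hl : ∀ K d T₁ T₂, y (Ctx.plug K (.delta (.node d T₁ T₂))) =
      y (Ctx.plug K (.node d (.delta T₁) T₂)))
    (hr : ∀ K d T₁ T₂, y (Ctx.plug K (.delta (.node d T₁ T₂))) =
      y (Ctx.plug K (.node d T₁ (.delta T₂))))
    {T : Tree α} (hT : T.deltas = 0) : diffCoeff T y = polar T fun t => y (.delta t) := by
  induction T generalizing y with
  | leaf a => rfl
  | delta t => simp [Tree.deltas] at hT
  | node d l r ihl ihr =>
    simp only [Tree.deltas, Nat.add_eq_zero_iff] at hT
    have el := ihl (y := fun t => y (.node d t r)) (fun K => hl (.left d K r))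
      (fun K => hr (.left d K r)) hT.1
    have er := ihr (y := fun t => y (.node d l t)) (fun K => hl (.right d l K))
      (fun K => hr (.right d l K)) hT.2
    have hl' : ∀ d T₁ T₂, y (.node d (.delta T₁) T₂) = y (.delta (.node d T₁ T₂)) :=
      fun d T₁ T₂ => (hl .hole d T₁ T₂).symm
    have hr' : ∀ d T₁ T₂, y (.node d T₁ (.delta T₂)) = y (.delta (.node d T₁ T₂)) :=
      fun d T₁ T₂ => (hr .hole d T₁ T₂).symm
    cases d <;> simp [diffCoeff, polar_node_prod, polar_node_brk, el, er, hl', hr', add_assoc]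

end Polar

/-! ## Vertex forms -/

section Cross

variable {α : Type} {V W : Type*} [AddCommGroup V] [AddCommGroup W]

/-- The sum of `f i j` over the entries `i` of one list and `j` of another. -/
def cross (f : α → α → V) (l r : List α) : V := (l.map fun i => (r.map (f i)).sum).sum

theorem cross_append_left (f : α → α → V) (l l' r : List α) :
    cross f (l ++ l') r = cross f l r + cross f l' r := by simp [cross]

theorem cross_append_right (f : α → α → V) (l r r' : List α) :
    cross f l (r ++ r') = cross f l r + cross f l r' := by
  simp [cross, List.sum_map_add]

theorem cross_comm {f : α → α → V} (hf : ∀ i j, f i j = f j i) (l r : List α) :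
    cross f l r = cross f r l := by
  induction l with
  | nil => simp [cross]
  | cons a l ih =>
    rw [← List.singleton_append, cross_append_left, cross_append_right, ih]
    simp [cross, funext (hf a)]

theorem cross_perm (f : α → α → V) {l l' r r' : List α} (hl : l.Perm l') (hr : r.Perm r') :
    cross f l r = cross f l' r' := by
  simp only [cross, (hl.map _).sum_eq, (hr.map _).sum_eq]

variable [Module ℂ V] [Module ℂ W]

theorem map_cross (d : V →ₗ[ℂ] W) (f : α → α → V) (l r : List α) :
    d (cross f l r) = cross (fun i j => d (f i j)) l r := by
  simp [cross, map_list_sum, Function.comp_def]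

/-- The sum of `f i j` over the unordered pairs of entries of a list, for `f` symmetric and zero on
the diagonal. -/
def pairSum (f : α → α → V) (l : List α) : V := (1 / 2 : ℂ) • cross f l l

theorem pairSum_append {f : α → α → V} (hf : ∀ i j, f i j = f j i) (l r : List α) :
    pairSum f (l ++ r) = cross f l r + pairSum f l + pairSum f r := by
  simp only [pairSum, cross_append_left, cross_append_right, cross_comm hf r l]
  module

theorem pairSum_perm (f : α → α → V) {l l' : List α} (h : l.Perm l') :
    pairSum f l = pairSum f l' := by rw [pairSum, pairSum, cross_perm f h h]

theorem map_pairSum (d : V →ₗ[ℂ] W) (f : α → α → V) (l : List α) :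
    d (pairSum f l) = pairSum (fun i j => d (f i j)) l := by
  simp only [pairSum, map_smul, map_cross]

theorem pairSum_finRange {k : ℕ} {f : Fin k → Fin k → V} (hf : ∀ i j, f i j = f j i)
    (hf' : ∀ i, f i i = 0) :
    pairSum f (List.finRange k) = ∑ i : Fin k, ∑ j ∈ Finset.Ioi i, f i j := by
  have h := Finset.sum_sum_Ioi_add_eq_sum_sum_off_diag f
  have hoff : ∀ i, ∑ j ∈ {i}ᶜ, f j i = ∑ j, f i j := fun i => by
    rw [← Finset.sum_compl_add_sum {i}, Finset.sum_singleton, hf', add_zero]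
    exact Finset.sum_congr rfl fun j _ => hf j i
  have hswap : ∀ i, ∑ j ∈ Finset.Ioi i, f j i = ∑ j ∈ Finset.Ioi i, f i j :=
    fun i => Finset.sum_congr rfl fun j _ => hf j i
  simp only [hoff, hswap, Finset.sum_add_distrib] at h
  simp only [pairSum, cross, ← Fin.sum_univ_def, ← h]
  module

end Cross

section VertexForm

open ExteriorAlgebra

variable {α : Type} {V W : Type*} [AddCommGroup V] [Module ℂ V] [AddCommGroup W] [Module ℂ W]

/-- The exterior product, over the product vertices of a tree from the root upwards, of the sums of
`e i j` with `i` above the left and `j` above the right input of the vertex. -/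
def vertexForm (e : α → α → V) : Tree α → ExteriorAlgebra ℂ V
  | .leaf _ => 1
  | .delta t => vertexForm e t
  | .node .prod l r => ι ℂ (cross e l.leaves r.leaves) * vertexForm e l * vertexForm e r
  | .node .brk l r => vertexForm e l * vertexForm e r

theorem ι_mul_ι_comm (u v : V) : ι ℂ u * ι ℂ v = -(ι ℂ v * ι ℂ u) :=
  eq_neg_of_add_eq_zero_left (ι_add_mul_swap u v)

theorem map_vertexForm (d : V →ₗ[ℂ] W) (e : α → α → V) (T : Tree α) :
    ExteriorAlgebra.map d (vertexForm e T) = vertexForm (fun i j => d (e i j)) T := by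
  induction T with
  | leaf => exact map_one _
  | delta _ ih => exact ih
  | node b l r ihl ihr =>
    cases b <;>
      simp only [vertexForm, map_mul, ihl, ihr, map_apply_ι, map_cross d]

theorem vertexForm_mul_ι (e : α → α → V) (T : Tree α) (v : V) :
    vertexForm e T * ι ℂ v = (-1 : ℂ) ^ T.prods • (ι ℂ v * vertexForm e T) := by
  induction T with
  | leaf a => simp [vertexForm, Tree.prods]
  | delta _ ih => exact ih
  | node b l r ihl ihr =>
    cases b
    · simp only [vertexForm, Tree.prods, if_true]
      rw [mul_assoc, ihr, mul_smul_comm, ← mul_assoc, mul_assoc _ (vertexForm e l), ihl,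
        mul_smul_comm, smul_mul_assoc, ← mul_assoc, ι_mul_ι_comm _ v]
      simp only [neg_mul, mul_assoc]
      module
    · simp only [vertexForm, Tree.prods, reduceCtorEq, if_false]
      rw [mul_assoc, ihr, mul_smul_comm, ← mul_assoc, ihl, smul_mul_assoc, mul_assoc]
      module

theorem sign_smul_vertexForm_mul_ι_mul (e : α → α → V) (T : Tree α) (v : V)
    (x : ExteriorAlgebra ℂ V) :
    (-1 : ℂ) ^ T.prods • (vertexForm e T * (ι ℂ v * x)) = ι ℂ v * vertexForm e T * x := by
  rw [← mul_assoc, vertexForm_mul_ι, smul_mul_assoc, smul_smul,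
    pow_mul_pow_eq_one _ (by norm_num), one_smul]

theorem vertexForm_mul_comm (e : α → α → V) (S T : Tree α) :
    vertexForm e S * vertexForm e T =
      (-1 : ℂ) ^ (S.prods * T.prods) • (vertexForm e T * vertexForm e S) := by
  induction T with
  | leaf a => simp [vertexForm, Tree.prods]
  | delta _ ih => exact ih
  | node b l r ihl ihr =>
    cases b
    · simp only [vertexForm, Tree.prods, if_true]
      rw [← mul_assoc, ← mul_assoc, vertexForm_mul_ι, smul_mul_assoc, smul_mul_assoc,
        mul_assoc _ (vertexForm e S), ihl, mul_smul_comm, smul_mul_assoc, ← mul_assoc, mul_assoc,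
        ihr, mul_smul_comm, ← mul_assoc]
      module
    · simp only [vertexForm, Tree.prods, reduceCtorEq, if_false]
      rw [← mul_assoc, ihl, smul_mul_assoc, mul_assoc, ihr, mul_smul_comm, mul_assoc]
      module

theorem polar_mul_left (T : Tree α) (x : ExteriorAlgebra ℂ V) (c : Tree α → ExteriorAlgebra ℂ V) :
    polar T (fun t => x * c t) = x * polar T c :=
  (map_polar (LinearMap.mulLeft ℂ x) T c).symm

theorem polar_mul_right (T : Tree α) (c : Tree α → ExteriorAlgebra ℂ V) (x : ExteriorAlgebra ℂ V) :
    polar T (fun t => c t * x) = polar T c * x :=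
  (map_polar (LinearMap.mulRight ℂ x) T c).symm

theorem polar_vertexForm {e : α → α → V} (he : ∀ i j, e i j = e j i) (he' : ∀ i, e i i = 0)
    (T : Tree α) : polar T (vertexForm e) = ι ℂ (pairSum e T.leaves) * vertexForm e T := by
  induction T with
  | leaf a => simp [polar_leaf, Tree.leaves, pairSum, cross, he']
  | delta _ ih => exact ih
  | node b l r ihl ihr =>
    rw [Tree.leaves, pairSum_append he, map_add, map_add]
    cases b
    · set C := ι ℂ (cross e l.leaves r.leaves) with hC
      have hl : polar l (fun l' => vertexForm e (.node .prod l' r)) =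
          C * (ι ℂ (pairSum e l.leaves) * vertexForm e l) * vertexForm e r := by
        rw [← ihl, ← polar_mul_left, ← polar_mul_right]
        exact polar_congr l fun l' h _ _ => by rw [vertexForm, h]
      have hr : polar r (fun r' => vertexForm e (.node .prod l r')) =
          C * vertexForm e l * (ι ℂ (pairSum e r.leaves) * vertexForm e r) := by
        rw [← ihr, ← polar_mul_left]
        exact polar_congr r fun r' h _ _ => by rw [vertexForm, h]
      have hanti (v : V) : C * ι ℂ v = -(ι ℂ v * C) := ι_mul_ι_comm _ _
      have hsq : C * C = 0 := ι_sq_zero _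
      rw [polar_node_prod, hl, hr, mul_assoc C (vertexForm e l), ← mul_smul_comm,
        sign_smul_vertexForm_mul_ι_mul, vertexForm, ← hC]
      simp only [← mul_assoc, add_mul, hanti, hsq, neg_mul, zero_mul]
      abel
    · simp only [polar_node_brk, vertexForm, polar_mul_left, polar_mul_right, ihl, ihr,
        sign_smul_vertexForm_mul_ι_mul]
      simp only [← mul_assoc, add_mul]

end VertexForm

section Relations

open ExteriorAlgebra

variable {α : Type} {V : Type*} [AddCommGroup V] [Module ℂ V] {e : α → α → V}

theorem cycSign_mul_self (T₁ T₂ T₃ : Tree α) : cycSign T₁ T₂ T₃ * cycSign T₁ T₂ T₃ = 1 :=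
  pow_mul_pow_eq_one _ (by norm_num)

theorem vertexForm_rotate (e : α → α → V) (T₁ T₂ T₃ : Tree α) :
    vertexForm e T₁ * (vertexForm e T₂ * vertexForm e T₃) =
      cycSign T₁ T₂ T₃ • (vertexForm e T₂ * (vertexForm e T₃ * vertexForm e T₁)) := by
  simpa [vertexForm, Tree.prods, cycSign, mul_assoc] using
    vertexForm_mul_comm e T₁ (.node .brk T₂ T₃)

theorem vertexForm_rotate' (e : α → α → V) (T₁ T₂ T₃ : Tree α) :
    vertexForm e T₁ * (vertexForm e T₂ * vertexForm e T₃) =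
      cycSign T₃ T₁ T₂ • (vertexForm e T₃ * (vertexForm e T₁ * vertexForm e T₂)) := by
  rw [vertexForm_rotate e T₃ T₁ T₂, smul_smul, cycSign_mul_self, one_smul]

theorem vertexForm_swap (he : ∀ i j, e i j = e j i) (d : Dec) (T₁ T₂ : Tree α) :
    vertexForm e (.node d T₁ T₂) =
      (-1 : ℂ) ^ (T₁.prods * T₂.prods) • vertexForm e (.node d T₂ T₁) := by
  cases d
  · simp only [vertexForm]
    rw [mul_assoc, vertexForm_mul_comm, mul_smul_comm, cross_comm he, mul_assoc]
  · exact vertexForm_mul_comm e T₁ T₂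

theorem vertexForm_assoc (he : ∀ i j, e i j = e j i) (T₁ T₂ T₃ : Tree α) :
    vertexForm e (.node .prod (.node .prod T₁ T₂) T₃) +
      cycSign T₁ T₂ T₃ • vertexForm e (.node .prod (.node .prod T₂ T₃) T₁) +
      cycSign T₃ T₁ T₂ • vertexForm e (.node .prod (.node .prod T₃ T₁) T₂) = 0 := by
  simp only [vertexForm, Tree.leaves, cross_append_left, map_add,
    cross_comm he T₁.leaves T₃.leaves, cross_comm he T₂.leaves T₁.leaves,
    cross_comm he T₃.leaves T₂.leaves, mul_assoc]
  set a := ι ℂ (cross e T₁.leaves T₂.leaves)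
  set b := ι ℂ (cross e T₂.leaves T₃.leaves)
  set c := ι ℂ (cross e T₃.leaves T₁.leaves)
  have hab : a * b = -(b * a) := ι_mul_ι_comm _ _
  have hac : a * c = -(c * a) := ι_mul_ι_comm _ _
  have hbc : b * c = -(c * b) := ι_mul_ι_comm _ _
  rw [← mul_smul_comm, ← mul_smul_comm, ← vertexForm_rotate, ← mul_smul_comm, ← mul_smul_comm,
    ← vertexForm_rotate']
  simp only [← mul_assoc, add_mul, hab, hac, hbc, neg_mul]
  abel

theorem vertexForm_jacobi (e : α → α → V) (T₁ T₂ T₃ : Tree α) :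
    vertexForm e (.node .brk (.node .brk T₁ T₂) T₃) =
      cycSign T₁ T₂ T₃ • vertexForm e (.node .brk (.node .brk T₂ T₃) T₁) := by
  simpa only [vertexForm, mul_assoc] using vertexForm_rotate e T₁ T₂ T₃

theorem vertexForm_leibniz (he : ∀ i j, e i j = e j i) (T₁ T₂ T₃ : Tree α) :
    vertexForm e (.node .prod (.node .brk T₁ T₂) T₃) =
      cycSign T₁ T₂ T₃ • vertexForm e (.node .brk (.node .prod T₂ T₃) T₁) +
      cycSign T₃ T₁ T₂ • vertexForm e (.node .brk (.node .prod T₃ T₁) T₂) := by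
  simp only [vertexForm, Tree.leaves, cross_append_left, map_add, cross_comm he T₁.leaves T₃.leaves,
    mul_assoc]
  rw [← mul_smul_comm, ← vertexForm_rotate, ← mul_smul_comm, ← vertexForm_rotate', ← add_mul,
    add_comm (ι ℂ _)]

end Relations

section Coefficients

open ExteriorAlgebra

variable {α : Type} {V : Type*} [AddCommGroup V] [Module ℂ V]

theorem Ctx.leaves_plug_perm (K : Ctx α) {X Y : Tree α} (h : X.leaves.Perm Y.leaves) :
    (K.plug X).leaves.Perm (K.plug Y).leaves := by
  induction K with
  | hole => exact h
  | delta _ ih => exact ih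
  | left _ K r ih => exact ih.append_right _
  | right _ l K ih => exact ih.append_left _

theorem Ctx.deltas_plug (K : Ctx α) {X Y : Tree α} (h : X.deltas = Y.deltas) :
    (K.plug X).deltas = (K.plug Y).deltas := by
  induction K with
  | hole => exact h
  | delta K ih | left d K r ih | right d l K ih => simp [Ctx.plug, Tree.deltas, ih]

theorem exists_vertexForm_plug (e : α → α → V) (K : Ctx α) (X₀ : Tree α) :
    ∃ f : ExteriorAlgebra ℂ V →ₗ[ℂ] ExteriorAlgebra ℂ V,
      ∀ X : Tree α, X.leaves.Perm X₀.leaves → vertexForm e (K.plug X) = f (vertexForm e X) := by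
  induction K with
  | hole => exact ⟨LinearMap.id, fun X _ => rfl⟩
  | delta _ ih => exact ih
  | left d K r ih =>
    obtain ⟨f, hf⟩ := ih
    cases d
    · refine ⟨LinearMap.mulLeft ℂ (ι ℂ (cross e (K.plug X₀).leaves r.leaves)) ∘ₗ
        LinearMap.mulRight ℂ (vertexForm e r) ∘ₗ f, fun X hX => ?_⟩
      simp [Ctx.plug, vertexForm, hf X hX, mul_assoc,
        cross_perm e (K.leaves_plug_perm hX) (List.Perm.refl r.leaves)]
    · exact ⟨LinearMap.mulRight ℂ (vertexForm e r) ∘ₗ f, fun X hX => by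
        simp [Ctx.plug, vertexForm, hf X hX]⟩
  | right d l K ih =>
    obtain ⟨f, hf⟩ := ih
    cases d
    · refine ⟨LinearMap.mulLeft ℂ (ι ℂ (cross e l.leaves (K.plug X₀).leaves) *
        vertexForm e l) ∘ₗ f, fun X hX => ?_⟩
      simp [Ctx.plug, vertexForm, hf X hX, mul_assoc,
        cross_perm e (List.Perm.refl l.leaves) (K.leaves_plug_perm hX)]
    · exact ⟨LinearMap.mulLeft ℂ (vertexForm e l) ∘ₗ f, fun X hX => by
        simp [Ctx.plug, vertexForm, hf X hX]⟩

/-- The element of the cofree cooperad with `m` vertices `Δ` in each tree whose coefficients are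
the values of a linear functional on the vertex forms. -/
def formCoeff {k : ℕ} (e : Fin k → Fin k → V) (φ : ExteriorAlgebra ℂ V →ₗ[ℂ] ℂ) (m : ℕ)
    (T : Tree (Fin k)) : ℂ :=
  open Classical in
  if T.leaves.Perm (List.finRange k) ∧ T.deltas = m then φ (vertexForm e T) else 0

variable {k : ℕ} {e : Fin k → Fin k → V} {m : ℕ}

theorem formCoeff_of_perm (φ : ExteriorAlgebra ℂ V →ₗ[ℂ] ℂ) {T : Tree (Fin k)}
    (h : T.leaves.Perm (List.finRange k)) (hm : T.deltas = m) :
    formCoeff e φ m T = φ (vertexForm e T) := if_pos ⟨h, hm⟩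

theorem exists_formCoeff_plug (e : Fin k → Fin k → V) (φ : ExteriorAlgebra ℂ V →ₗ[ℂ] ℂ) (m : ℕ)
    (K : Ctx (Fin k)) (X₀ : Tree (Fin k)) :
    ∃ ψ : ExteriorAlgebra ℂ V →ₗ[ℂ] ℂ, ∀ X : Tree (Fin k), X.leaves.Perm X₀.leaves →
      X.deltas = X₀.deltas → formCoeff e φ m (K.plug X) = ψ (vertexForm e X) := by
  obtain ⟨f, hf⟩ := exists_vertexForm_plug e K X₀
  by_cases h : (K.plug X₀).leaves.Perm (List.finRange k) ∧ (K.plug X₀).deltas = m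
  · refine ⟨φ ∘ₗ f, fun X h₁ h₂ => ?_⟩
    rw [formCoeff_of_perm φ ((K.leaves_plug_perm h₁).trans h.1) ((K.deltas_plug h₂).trans h.2),
      hf X h₁, LinearMap.comp_apply]
  · refine ⟨0, fun X h₁ h₂ => if_neg fun h' => h ⟨?_, ?_⟩⟩
    · exact (K.leaves_plug_perm h₁).symm.trans h'.1
    · exact (K.deltas_plug h₂).symm.trans h'.2

theorem perm_rotate (a b c : List α) : ((b ++ c) ++ a).Perm ((a ++ b) ++ c) := by
  rw [List.append_assoc a]
  exact List.perm_append_comm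

theorem exists_cubic_formCoeff (e : Fin k → Fin k → V) (φ : ExteriorAlgebra ℂ V →ₗ[ℂ] ℂ) (m : ℕ)
    (K : Ctx (Fin k)) (T₁ T₂ T₃ : Tree (Fin k)) :
    ∃ ψ : ExteriorAlgebra ℂ V →ₗ[ℂ] ℂ, ∀ a b,
      cubic (formCoeff e φ m) K a b T₁ T₂ T₃ = ψ (vertexForm e (.node a (.node b T₁ T₂) T₃)) ∧
      cubic (formCoeff e φ m) K a b T₂ T₃ T₁ = ψ (vertexForm e (.node a (.node b T₂ T₃) T₁)) ∧
      cubic (formCoeff e φ m) K a b T₃ T₁ T₂ = ψ (vertexForm e (.node a (.node b T₃ T₁) T₂)) := by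
  obtain ⟨ψ, hψ⟩ := exists_formCoeff_plug e φ m K (.node .brk (.node .brk T₁ T₂) T₃)
  refine ⟨ψ, fun a b => ⟨hψ _ (List.Perm.refl _) rfl, hψ _ (perm_rotate _ _ _) ?_,
    hψ _ (perm_rotate _ _ _).symm ?_⟩⟩ <;> simp only [Tree.deltas] <;> ring

theorem isKoszulDual_formCoeff (he : ∀ i j, e i j = e j i) (φ : ExteriorAlgebra ℂ V →ₗ[ℂ] ℂ)
    (m : ℕ) : IsKoszulDual (formCoeff e φ m) where
  labels T hT := by
    by_contra h
    exact hT (if_neg fun h' => h h'.1)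
  swap K d T₁ T₂ := by
    obtain ⟨ψ, hψ⟩ := exists_formCoeff_plug e φ m K (.node d T₁ T₂)
    rw [hψ _ (List.Perm.refl _) rfl, hψ (.node d T₂ T₁) List.perm_append_comm (add_comm _ _),
      vertexForm_swap he, map_smul, smul_eq_mul]
  assoc K T₁ T₂ T₃ := by
    obtain ⟨ψ, hψ⟩ := exists_cubic_formCoeff e φ m K T₁ T₂ T₃
    simpa [hψ] using congrArg ψ (vertexForm_assoc he T₁ T₂ T₃)
  jacobi K T₁ T₂ T₃ := by
    obtain ⟨ψ, hψ⟩ := exists_cubic_formCoeff e φ m K T₁ T₂ T₃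
    simpa [hψ] using congrArg ψ (vertexForm_jacobi e T₁ T₂ T₃)
  leibniz K T₁ T₂ T₃ := by
    obtain ⟨ψ, hψ⟩ := exists_cubic_formCoeff e φ m K T₁ T₂ T₃
    simpa [hψ] using congrArg ψ (vertexForm_leibniz he T₁ T₂ T₃)
  delta_left K d T₁ T₂ := by
    obtain ⟨ψ, hψ⟩ := exists_formCoeff_plug e φ m K (.delta (.node d T₁ T₂))
    rw [hψ _ (List.Perm.refl _) rfl,
      hψ (.node d (.delta T₁) T₂) (List.Perm.refl _) (by simp [Tree.deltas]; ring)]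
    cases d <;> rfl
  delta_right K d T₁ T₂ := by
    obtain ⟨ψ, hψ⟩ := exists_formCoeff_plug e φ m K (.delta (.node d T₁ T₂))
    rw [hψ _ (List.Perm.refl _) rfl,
      hψ (.node d T₁ (.delta T₂)) (List.Perm.refl _) (by simp [Tree.deltas]; ring)]
    cases d <;> rfl

theorem formCoeff_mem (he : ∀ i j, e i j = e j i) (φ : ExteriorAlgebra ℂ V →ₗ[ℂ] ℂ) (m : ℕ) :
    formCoeff e φ m ∈ BVcoDelta k m :=
  ⟨isKoszulDual_formCoeff he φ m, fun _ hT => if_neg fun h => hT h.2⟩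

theorem diff_apply_eq_polar {c : Tree (Fin k) → ℂ} (hc : IsKoszulDual c) {T : Tree (Fin k)}
    (hT : T.deltas = 0) : diff k c T = polar T fun t => c (.delta t) :=
  diffCoeff_eq_polar hc.delta_left hc.delta_right hT

theorem diff_formCoeff (he : ∀ i j, e i j = e j i) (he' : ∀ i, e i i = 0)
    (φ : ExteriorAlgebra ℂ V →ₗ[ℂ] ℂ) :
    diff k (formCoeff e φ 1) =
      formCoeff e (φ ∘ₗ LinearMap.mulLeft ℂ (ι ℂ (pairSum e (List.finRange k)))) 0 := by
  funext T
  by_cases h : T.leaves.Perm (List.finRange k) ∧ T.deltas = 0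
  · have hT' : polar T (fun t => formCoeff e φ 1 (.delta t)) =
        polar T fun t => φ (vertexForm e t) :=
      polar_congr T fun T' h₁ _ h₃ =>
        formCoeff_of_perm φ (T := .delta T') (by simpa [Tree.leaves, h₁] using h.1)
          (by simp [Tree.deltas, h₃, h.2])
    rw [diff_apply_eq_polar (isKoszulDual_formCoeff he φ 1) h.2, hT', ← map_polar,
      polar_vertexForm he he', pairSum_perm e h.1, formCoeff_of_perm _ h.1 h.2]
    rfl
  · refine ((diffCoeff_congr T fun T' h₁ h₃ => ?_).trans
      (map_zero (LinearMap.proj T ∘ₗ diff k))).trans (if_neg h).symm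
    refine if_neg fun h' => h ?_
    rw [h₁, h₃] at h'
    exact ⟨h'.1, by omega⟩

end Coefficients

/-! ## Trees with at most one product -/

section ContextEq

variable {α : Type}

/-- Composition of contexts. -/
def Ctx.comp : Ctx α → Ctx α → Ctx α
  | .hole, K' => K'
  | .delta K, K' => .delta (K.comp K')
  | .left d K r, K' => .left d (K.comp K') r
  | .right d l K, K' => .right d l (K.comp K')

theorem Ctx.plug_comp (K K' : Ctx α) (T : Tree α) : (K.comp K').plug T = K.plug (K'.plug T) := by
  induction K with
  | hole => rfl
  | delta K ih | left d K r ih | right d l K ih => simp [Ctx.comp, Ctx.plug, ih]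

/-- Two trees are related if they have the same coefficient in `c` in every context. -/
def ContextEq (c : Tree α → ℂ) (T T' : Tree α) : Prop := ∀ K : Ctx α, c (K.plug T) = c (K.plug T')

/-- The left comb `[…[[X, a₁], a₂], …]`. -/
def comb (X : Tree α) (l : List α) : Tree α := l.foldl (fun t a => .node .brk t (.leaf a)) X

@[simp] theorem comb_nil (X : Tree α) : comb X [] = X := rfl

@[simp] theorem comb_cons (X : Tree α) (a : α) (l : List α) :
    comb X (a :: l) = comb (.node .brk X (.leaf a)) l := rfl

theorem comb_append (X : Tree α) (l l' : List α) : comb X (l ++ l') = comb (comb X l) l' :=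
  List.foldl_append

@[simp] theorem prods_comb (X : Tree α) (l : List α) : (comb X l).prods = X.prods := by
  induction l generalizing X with
  | nil => rfl
  | cons a l ih => simp [ih, Tree.prods]

@[simp] theorem deltas_comb (X : Tree α) (l : List α) : (comb X l).deltas = X.deltas := by
  induction l generalizing X with
  | nil => rfl
  | cons a l ih => simp [ih, Tree.deltas]

@[simp] theorem leaves_comb (X : Tree α) (l : List α) : (comb X l).leaves = X.leaves ++ l := by
  induction l generalizing X with
  | nil => simp
  | cons a l ih => simp [ih, Tree.leaves]

@[simp] theorem vertexForm_comb {V : Type*} [AddCommGroup V] [Module ℂ V] (e : α → α → V)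
    (X : Tree α) (l : List α) : vertexForm e (comb X l) = vertexForm e X := by
  induction l generalizing X with
  | nil => rfl
  | cons a l ih => simp [ih, vertexForm]

theorem exists_ctx_comb (l : List α) : ∃ K : Ctx α, ∀ X, K.plug X = comb X l := by
  induction l with
  | nil => exact ⟨.hole, fun X => rfl⟩
  | cons a l ih =>
    obtain ⟨K, hK⟩ := ih
    exact ⟨K.comp (.left .brk .hole (.leaf a)), fun X => by simp [Ctx.plug_comp, Ctx.plug, hK]⟩

namespace ContextEq

variable {c : Tree α → ℂ} {T T' T'' : Tree α}

theorem refl (c : Tree α → ℂ) (T : Tree α) : ContextEq c T T := fun _ => rfl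

theorem symm (h : ContextEq c T T') : ContextEq c T' T := fun K => (h K).symm

theorem trans (h : ContextEq c T T') (h' : ContextEq c T' T'') : ContextEq c T T'' :=
  fun K => (h K).trans (h' K)

theorem plug (h : ContextEq c T T') (K : Ctx α) : ContextEq c (K.plug T) (K.plug T') := fun K' => by
  simpa only [Ctx.plug_comp] using h (K'.comp K)

theorem node_left (h : ContextEq c T T') (d : Dec) (r : Tree α) :
    ContextEq c (.node d T r) (.node d T' r) := h.plug (.left d .hole r)

theorem node_right (h : ContextEq c T T') (d : Dec) (l : Tree α) :
    ContextEq c (.node d l T) (.node d l T') := h.plug (.right d l .hole)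

theorem comb (h : ContextEq c T T') (l : List α) : ContextEq c (comb T l) (comb T' l) := by
  obtain ⟨K, hK⟩ := exists_ctx_comb l
  simpa only [hK] using h.plug K

end ContextEq

end ContextEq

section AtMostOneProduct

variable {k : ℕ}

namespace IsKoszulDual

variable {c : Tree (Fin k) → ℂ}

theorem node_comm (hc : IsKoszulDual c) (d : Dec) {T₁ T₂ : Tree (Fin k)}
    (h : T₁.prods * T₂.prods = 0) :
    ContextEq c (.node d T₁ T₂) (.node d T₂ T₁) := fun K => by
  rw [hc.swap, h, pow_zero, one_mul]

theorem brk_assoc (hc : IsKoszulDual c) {T₁ T₂ T₃ : Tree (Fin k)}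
    (h : T₁.prods + T₂.prods + T₃.prods ≤ 1) :
    ContextEq c (.node .brk (.node .brk T₁ T₂) T₃) (.node .brk T₁ (.node .brk T₂ T₃)) := by
  have hsign : T₁.prods * (T₂.prods + T₃.prods) = 0 :=
    mul_eq_zero.2 (by omega)
  refine ContextEq.trans (fun K => ?_) (hc.node_comm .brk (T₁ := .node .brk T₂ T₃) (T₂ := T₁) ?_)
  · simpa [cycSign, hsign, cubic] using hc.jacobi K T₁ T₂ T₃
  · simpa [Tree.prods, mul_comm] using hsign

theorem brk_eq_comb (hc : IsKoszulDual c) {X T : Tree (Fin k)} (hX : X.prods ≤ 1)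
    (hT : T.prods = 0) (hT' : T.deltas = 0) :
    ContextEq c (.node .brk X T) (comb X T.leaves) := by
  induction T generalizing X with
  | leaf a => exact ContextEq.refl _ _
  | delta => simp [Tree.deltas] at hT'
  | node d l r ihl ihr =>
    cases d
    · simp [Tree.prods] at hT
    · simp only [Tree.prods, reduceCtorEq, if_false, zero_add, Nat.add_eq_zero_iff] at hT
      simp only [Tree.deltas, Nat.add_eq_zero_iff] at hT'
      rw [Tree.leaves, comb_append]
      exact (hc.brk_assoc (by omega)).symm.trans (((ihl hX hT.1 hT'.1).node_left .brk r).trans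
        (ihr (by simpa using hX) hT.2 hT'.2))

theorem comb_perm (hc : IsKoszulDual c) {X : Tree (Fin k)} (hX : X.prods ≤ 1)
    {l l' : List (Fin k)} (h : l.Perm l') : ContextEq c (comb X l) (comb X l') := by
  induction h generalizing X with
  | nil => exact ContextEq.refl _ _
  | cons a _ ih => exact ih (by simpa [Tree.prods] using hX)
  | swap a b l =>
    have hassoc (a b : Fin k) := hc.brk_assoc (T₁ := X) (T₂ := .leaf a) (T₃ := .leaf b)
      (by simpa [Tree.prods] using hX)
    exact ((hassoc b a).trans (((hc.node_comm .brk (by simp [Tree.prods])).node_right _ _).trans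
      (hassoc a b).symm)).comb l
  | trans _ _ ih₁ ih₂ => exact (ih₁ hX).trans (ih₂ hX)

theorem exists_eq_comb_leaf (hc : IsKoszulDual c) {T : Tree (Fin k)} (hT : T.prods = 0)
    (hT' : T.deltas = 0) {a : Fin k} (ha : a ∈ T.leaves) :
    ∃ l, T.leaves.Perm (a :: l) ∧ ContextEq c T (comb (.leaf a) l) := by
  induction T with
  | leaf b =>
    obtain rfl := List.mem_singleton.1 ha
    exact ⟨[], List.Perm.refl _, ContextEq.refl _ _⟩
  | delta => simp [Tree.deltas] at hT'
  | node d l r ihl ihr =>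
    cases d
    · simp [Tree.prods] at hT
    simp only [Tree.prods, reduceCtorEq, if_false, zero_add, Nat.add_eq_zero_iff] at hT
    simp only [Tree.deltas, Nat.add_eq_zero_iff] at hT'
    have brk_comb {m : List (Fin k)} {t : Tree (Fin k)} (ht : t.prods = 0) (ht' : t.deltas = 0) :
        ContextEq c (.node .brk (comb (.leaf a) m) t) (comb (.leaf a) (m ++ t.leaves)) := by
      rw [comb_append]
      exact hc.brk_eq_comb (by simp [Tree.prods]) ht ht'
    rcases List.mem_append.1 ha with ha | ha
    · obtain ⟨m, hm, hlm⟩ := ihl hT.1 hT'.1 ha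
      exact ⟨m ++ r.leaves, hm.append_right _, (hlm.node_left _ _).trans (brk_comb hT.2 hT'.2)⟩
    · obtain ⟨m, hm, hrm⟩ := ihr hT.2 hT'.2 ha
      exact ⟨m ++ l.leaves, List.perm_append_comm.trans (hm.append_right _),
        (hc.node_comm _ (by simp [hT.1])).trans
          ((hrm.node_left _ _).trans (brk_comb hT.1 hT'.1))⟩

theorem apply_eq_of_prods_eq_zero (hc : IsKoszulDual c) (hk : 0 < k) {T T' : Tree (Fin k)}
    (hT : T.prods = 0) (hT' : T'.prods = 0) (h : T.deltas = 0) (h' : T'.deltas = 0)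
    (hp : T.leaves.Perm (List.finRange k)) (hp' : T'.leaves.Perm (List.finRange k)) :
    c T = c T' := by
  have mem_leaves {T : Tree (Fin k)} (hp : T.leaves.Perm (List.finRange k)) :
      ⟨0, hk⟩ ∈ T.leaves := hp.mem_iff.2 (List.mem_finRange _)
  obtain ⟨l, hl, hTl⟩ := hc.exists_eq_comb_leaf hT h (mem_leaves hp)
  obtain ⟨l', hl', hTl'⟩ := hc.exists_eq_comb_leaf hT' h' (mem_leaves hp')
  have hll' : l.Perm l' := (List.perm_cons _).1 (hl.symm.trans ((hp.trans hp'.symm).trans hl'))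
  exact (hTl.trans ((hc.comb_perm (by simp [Tree.prods]) hll').trans hTl'.symm)) .hole

theorem comb_prod_comm (hc : IsKoszulDual c) {l r : Tree (Fin k)} (hl : l.prods = 0)
    (m : List (Fin k)) : c (comb (.node .prod l r) m) = c (comb (.node .prod r l) m) :=
  (hc.node_comm .prod (by simp [hl])).comb m .hole

theorem comb_leibniz (hc : IsKoszulDual c) {T₁ T₂ T₃ : Tree (Fin k)}
    (h : T₁.prods = 0 ∧ T₂.prods = 0 ∧ T₃.prods = 0) (h' : T₁.deltas = 0 ∧ T₂.deltas = 0)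
    (m : List (Fin k)) :
    c (comb (.node .prod (.node .brk T₁ T₂) T₃) m) =
      c (comb (.node .prod T₂ T₃) (T₁.leaves ++ m)) +
      c (comb (.node .prod T₃ T₁) (T₂.leaves ++ m)) := by
  obtain ⟨K, hK⟩ := exists_ctx_comb m
  rw [comb_append, comb_append, ← hK, ← hK, ← hK,
    ← hc.brk_eq_comb (by simp [Tree.prods, h]) h.1 h'.1 K,
    ← hc.brk_eq_comb (by simp [Tree.prods, h]) h.2.1 h'.2 K]
  simpa [cycSign, h, cubic] using hc.leibniz K T₁ T₂ T₃

theorem comb_prod_eq_zero (hc : IsKoszulDual c)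
    (h₀ : ∀ i j m, c (comb (.node .prod (.leaf i) (.leaf j)) m) = 0) {l r : Tree (Fin k)}
    (hl : l.prods = 0) (hl' : l.deltas = 0) (hr : r.prods = 0) (hr' : r.deltas = 0)
    (m : List (Fin k)) : c (comb (.node .prod l r) m) = 0 := by
  induction l generalizing r m with
  | delta => simp [Tree.deltas] at hl'
  | node d l₁ l₂ ih₁ ih₂ =>
    cases d
    · simp [Tree.prods] at hl
    simp only [Tree.prods, reduceCtorEq, if_false, zero_add, Nat.add_eq_zero_iff] at hl
    simp only [Tree.deltas, Nat.add_eq_zero_iff] at hl'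
    rw [hc.comb_leibniz ⟨hl.1, hl.2, hr⟩ hl', hc.comb_prod_comm hr, ih₁ hl.1 hl'.1 hr hr',
      ih₂ hl.2 hl'.2 hr hr', add_zero]
  | leaf i =>
    rw [hc.comb_prod_comm (l := .leaf i) rfl]
    induction r generalizing m with
    | leaf j => exact h₀ _ _ _
    | delta => simp [Tree.deltas] at hr'
    | node d r₁ r₂ ih₁ ih₂ =>
      cases d
      · simp [Tree.prods] at hr
      simp only [Tree.prods, reduceCtorEq, if_false, zero_add, Nat.add_eq_zero_iff] at hr
      simp only [Tree.deltas, Nat.add_eq_zero_iff] at hr'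
      rw [hc.comb_leibniz ⟨hr.1, hr.2, rfl⟩ hr', hc.comb_prod_comm (l := .leaf i) rfl,
        ih₁ hr.1 hr'.1, ih₂ hr.2 hr'.2, add_zero]

theorem comb_eq_zero_of_prods_eq_one (hc : IsKoszulDual c)
    (h₀ : ∀ i j m, c (comb (.node .prod (.leaf i) (.leaf j)) m) = 0) {T : Tree (Fin k)}
    (hT : T.prods = 1) (hT' : T.deltas = 0) (m : List (Fin k)) : c (comb T m) = 0 := by
  induction T generalizing m with
  | leaf a => simp [Tree.prods] at hT
  | delta => simp [Tree.deltas] at hT'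
  | node d l r ihl ihr =>
    simp only [Tree.deltas, Nat.add_eq_zero_iff] at hT'
    cases d
    · simp only [Tree.prods, if_true, add_assoc, Nat.add_eq_left, Nat.add_eq_zero_iff] at hT
      exact hc.comb_prod_eq_zero h₀ hT.1 hT'.1 hT.2 hT'.2 m
    · simp only [Tree.prods, reduceCtorEq, if_false, zero_add, Nat.add_eq_one_iff] at hT
      rcases hT with ⟨hl, hr⟩ | ⟨hl, hr⟩
      · have hlr := (hc.node_comm .brk (by simp [hl])).trans (hc.brk_eq_comb hr.le hl hT'.1)
        exact (hlr.comb m .hole).trans (comb_append r l.leaves m ▸ ihr hr hT'.2 _)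
      · exact ((hc.brk_eq_comb hl.le hr hT'.2).comb m .hole).trans
          (comb_append l r.leaves m ▸ ihl hl hT'.1 _)

end IsKoszulDual

end AtMostOneProduct

/-! ## Exactness for at most one product -/

section LowDegree

open ExteriorAlgebra

variable {α : Type} {V : Type*} [AddCommGroup V] [Module ℂ V]

theorem algebraMapInv_ι (v : V) : algebraMapInv (ι ℂ v) = (0 : ℂ) := by
  simp [algebraMapInv]

theorem ιInv_mul (x y : ExteriorAlgebra ℂ V) :
    ιInv (x * y) = algebraMapInv x • ιInv y + algebraMapInv y • ιInv x := by
  let : Module ℂᵐᵒᵖ V := Module.compHom _ ((RingHom.id ℂ).fromOpposite mul_comm)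
  have : IsCentralScalar ℂ V := ⟨fun r m => rfl⟩
  have hfst : (TrivSqZeroExt.fstHom ℂ ℂ V).comp toTrivSqZeroExt = algebraMapInv := by
    ext v
    simp [algebraMapInv_ι]
  simp only [← hfst, AlgHom.comp_apply, TrivSqZeroExt.fstHom_apply]
  change (toTrivSqZeroExt (x * y)).snd = _ • (toTrivSqZeroExt y).snd + _ • (toTrivSqZeroExt x).snd
  rw [map_mul, TrivSqZeroExt.snd_mul, op_smul_eq_smul]

theorem algebraMapInv_vertexForm (e : α → α → V) (T : Tree α) :
    algebraMapInv (vertexForm e T) = if T.prods = 0 then (1 : ℂ) else 0 := by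
  induction T with
  | leaf a => simp [vertexForm, Tree.prods]
  | delta _ ih => exact ih
  | node d l r ihl ihr =>
    cases d
    · simp [vertexForm, Tree.prods, algebraMapInv_ι]
    · simp [vertexForm, Tree.prods, ihl, ihr, ← ite_and, and_comm]

theorem ιInv_vertexForm_eq_zero (e : α → α → V) {T : Tree α} (hT : T.prods ≠ 1) :
    ιInv (vertexForm e T) = 0 := by
  induction T with
  | leaf a =>
    simpa [vertexForm] using ιInv_mul (1 : ExteriorAlgebra ℂ V) 1
  | delta t ih => exact ih hT
  | node d l r ihl ihr =>
    cases d
    · simp only [Tree.prods, if_true] at hT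
      simp only [vertexForm, mul_assoc, ιInv_mul, map_mul, algebraMapInv_ι,
        algebraMapInv_vertexForm]
      by_cases hl : l.prods = 0 <;> by_cases hr : r.prods = 0 <;> simp [hl, hr]
      omega
    · simp only [Tree.prods, reduceCtorEq, if_false, zero_add] at hT
      simp only [vertexForm, ιInv_mul, algebraMapInv_vertexForm]
      by_cases hl : l.prods = 0 <;> by_cases hr : r.prods = 0
      · simp [hl, hr, ihl, ihr]
      · simp [hl, hr, ihr (by omega)]
      · simp [hl, hr, ihl (by omega)]
      · simp [hl, hr]

end LowDegree

section Cogenerators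

open ExteriorAlgebra

theorem Tree.length_leaves {α : Type} (T : Tree α) :
    T.leaves.length = T.prods + T.brks + 1 := by
  induction T with
  | leaf a => rfl
  | delta _ ih => exact ih
  | node d l r ihl ihr =>
    cases d <;> simp [Tree.leaves, Tree.prods, Tree.brks, ihl, ihr] <;> ring

variable {k : ℕ}

theorem prods_add_brks {T : Tree (Fin k)} (h : T.leaves.Perm (List.finRange k)) :
    T.prods + T.brks + 1 = k := by
  rw [← T.length_leaves, h.length_eq, List.length_finRange]

theorem pairTree_eq_comb (i j : Fin k) : pairTree i j =
    comb (.node .prod (.leaf i) (.leaf j))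
      ((List.finRange k).filter fun a => a ≠ i ∧ a ≠ j) := rfl

/-- The coefficients at the trees `pairTree i j`, extended by zero to the diagonal. -/
def pairCoeff (c : Tree (Fin k) → ℂ) (i j : Fin k) : ℂ := if i = j then 0 else c (pairTree i j)

theorem pairCoeff_self (c : Tree (Fin k) → ℂ) (i : Fin k) : pairCoeff c i i = 0 := if_pos rfl

theorem perm_filter_of_perm_finRange {i j : Fin k} {m : List (Fin k)}
    (h : (i :: j :: m).Perm (List.finRange k)) :
    i ≠ j ∧ m.Perm ((List.finRange k).filter fun a => a ≠ i ∧ a ≠ j) := by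
  have hn : (i :: j :: m).Nodup := h.nodup_iff.2 (List.nodup_finRange k)
  simp only [List.nodup_cons, List.mem_cons, not_or] at hn
  refine ⟨hn.1.1, (List.perm_ext_iff_of_nodup hn.2.2 ((List.nodup_finRange k).filter _)).2
    fun a => ?_⟩
  have ha : a ∈ i :: j :: m := h.mem_iff.2 (List.mem_finRange a)
  grind

namespace IsKoszulDual

variable {c : Tree (Fin k) → ℂ}

theorem pairCoeff_comm (hc : IsKoszulDual c) (i j : Fin k) :
    pairCoeff c i j = pairCoeff c j i := by
  by_cases h : i = j
  · rw [h]
  · simpa only [pairCoeff, h, Ne.symm h, if_false, pairTree_eq_comb, and_comm (a := _ ≠ i)]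
      using hc.comb_prod_comm rfl _

theorem apply_comb_prod_leaf (hc : IsKoszulDual c) {i j : Fin k} {m : List (Fin k)}
    (h : (i :: j :: m).Perm (List.finRange k)) :
    c (comb (.node .prod (.leaf i) (.leaf j)) m) = pairCoeff c i j := by
  obtain ⟨hij, hm⟩ := perm_filter_of_perm_finRange h
  rw [pairCoeff, if_neg hij, pairTree_eq_comb]
  exact hc.comb_perm (by simp [Tree.prods]) hm .hole

theorem apply_eq_ιInv_vertexForm (hc : IsKoszulDual c) {T : Tree (Fin k)} (hT : T.prods = 1)
    (hT' : T.deltas = 0) (hp : T.leaves.Perm (List.finRange k)) :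
    c T = ιInv (vertexForm (pairCoeff c) T) := by
  have hsub : IsKoszulDual (c - formCoeff (pairCoeff c) ιInv 0) :=
    (BVco k).sub_mem hc (isKoszulDual_formCoeff hc.pairCoeff_comm _ _)
  have hzero := hsub.comb_eq_zero_of_prods_eq_one (fun i j m => ?_) hT hT' []
  · rwa [comb_nil, Pi.sub_apply, formCoeff_of_perm _ hp hT', sub_eq_zero] at hzero
  · set X := comb (.node .prod (.leaf i) (.leaf j)) m
    by_cases hX : X.leaves.Perm (List.finRange k)
    · rw [Pi.sub_apply, formCoeff_of_perm _ hX (by simp [X, Tree.deltas]), sub_eq_zero,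
        hc.apply_comb_prod_leaf (by simpa [X, Tree.leaves] using hX)]
      simp [X, vertexForm, Tree.leaves, cross, ι_leftInverse _]
    · exact not_not.1 fun h => hX (hsub.labels X h)

end IsKoszulDual

theorem cogen_eq_pairSum (c : BVcoDelta k 0) :
    cogen k c = pairSum (pairCoeff c.1) (List.finRange k) := by
  have hc : IsKoszulDual c.1 := c.2.1
  rw [pairSum_finRange hc.pairCoeff_comm (pairCoeff_self _)]
  simp only [cogen, LinearMap.comp_apply, LinearMap.sum_apply, LinearMap.proj_apply,
    Submodule.subtype_apply]
  refine Finset.sum_congr rfl fun i _ => Finset.sum_congr rfl fun j hj => ?_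
  rw [pairCoeff, if_neg (Finset.mem_Ioi.1 hj).ne]

theorem polar_eq_cogen (c : BVcoDelta k 0) {T : Tree (Fin k)} (hT : T.prods = 0)
    (hT' : T.deltas = 0) (hp : T.leaves.Perm (List.finRange k)) : polar T c.1 = cogen k c := by
  have hc : IsKoszulDual c.1 := c.2.1
  have hcoord : polar T c.1 = polar T fun t => ιInv (vertexForm (pairCoeff c.1) t) :=
    polar_congr T fun T' h₁ h₂ h₃ =>
      hc.apply_eq_ιInv_vertexForm (by omega) (by omega) (h₁ ▸ hp)
  rw [hcoord, ← map_polar, polar_vertexForm hc.pairCoeff_comm (pairCoeff_self _), ιInv_mul,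
    algebraMapInv_ι, algebraMapInv_vertexForm, if_pos hT, zero_smul, zero_add, one_smul,
    ι_leftInverse, cogen_eq_pairSum, pairSum_perm _ hp]

theorem exists_tree_prods_eq_zero (hk : 0 < k) : ∃ T : Tree (Fin k), T.prods = 0 ∧ T.deltas = 0 ∧
    T.leaves.Perm (List.finRange k) := by
  obtain ⟨m, rfl⟩ : ∃ m, k = m + 1 := ⟨k - 1, by omega⟩
  refine ⟨comb (.leaf 0) ((List.finRange m).map Fin.succ), by simp [Tree.prods],
    by simp [Tree.deltas], ?_⟩
  rw [leaves_comb, List.finRange_succ]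
  rfl

theorem cogen_eq_zero_of_mem_boundaries (hk : 0 < k) {c : BVcoDelta k 0}
    (hc : c ∈ boundaries k) : cogen k c = 0 := by
  obtain ⟨y, hy, hyc⟩ := Submodule.mem_map.1 (Submodule.mem_comap.1 hc)
  have hyc : diff k y = c.1 := hyc
  obtain ⟨T, hT, hT', hp⟩ := exists_tree_prods_eq_zero hk
  rw [← polar_eq_cogen c hT hT' hp, ← polar_polar T fun t => y (.delta t), ← hyc]
  exact polar_congr T fun T' _ _ h₃ => diff_apply_eq_polar hy.1 (by omega)

/-- The symmetric function of pairs of distinct labels that is constant with total sum one. -/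
def unitPair (k : ℕ) (i j : Fin k) : ℂ := if i = j then 0 else 2 / (k * (k - 1))

theorem unitPair_comm (i j : Fin k) : unitPair k i j = unitPair k j i := by
  simp [unitPair, eq_comm]

theorem unitPair_self (i : Fin k) : unitPair k i i = 0 := if_pos rfl

theorem pairSum_unitPair (hk : 2 ≤ k) : pairSum (unitPair k) (List.finRange k) = 1 := by
  have hk₀ : (k : ℂ) ≠ 0 := by exact_mod_cast (by omega : k ≠ 0)
  have hk₁ : (k : ℂ) - 1 ≠ 0 := sub_ne_zero.2 (by exact_mod_cast (by omega : k ≠ 1))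
  have hrow (i : Fin k) : ∑ j, unitPair k i j = 2 / k := by
    simp only [unitPair, ← ite_not (p := i = _), Finset.sum_ite, Finset.sum_const_zero, add_zero,
      Finset.sum_const, nsmul_eq_mul, Finset.filter_ne, Finset.card_erase_of_mem,
      Finset.mem_univ, Finset.card_univ, Fintype.card_fin, Nat.cast_pred (by omega : 0 < k)]
    field_simp
  simp only [pairSum, cross, ← Fin.sum_univ_def, hrow, Finset.sum_const, Finset.card_univ,
    Fintype.card_fin, nsmul_eq_mul, smul_eq_mul]
  field_simp

/- The differential multiplies vertex forms by `E = ∑ e i j`. Adjoining a second coordinate in which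
the sum is `1`, contraction with that coordinate is a homotopy for the multiplication. -/
theorem formCoeff_mem_map_diff {V : Type*} [AddCommGroup V] [Module ℂ V] (hk : 2 ≤ k)
    {e : Fin k → Fin k → V} (he : ∀ i j, e i j = e j i) (he' : ∀ i, e i i = 0)
    {φ : ExteriorAlgebra ℂ V →ₗ[ℂ] ℂ}
    (hφ : φ ∘ₗ LinearMap.mulLeft ℂ (ι ℂ (pairSum e (List.finRange k))) = 0) :
    formCoeff e φ 0 ∈ (BVcoDelta k 1).map (diff k) := by
  set e₁ : Fin k → Fin k → V × ℂ := fun i j => (e i j, unitPair k i j) with he₁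
  have he₁_comm (i j) : e₁ i j = e₁ j i := by simp [he₁, he i j, unitPair_comm i j]
  have he₁_self (i) : e₁ i i = 0 := by simp [he₁, he', unitPair_self]
  have hfst (x) : φ (ι ℂ (pairSum e (List.finRange k)) * x) = 0 := LinearMap.congr_fun hφ x
  have hsnd : (pairSum e₁ (List.finRange k)).2 = 1 :=
    (map_pairSum (LinearMap.snd ℂ V ℂ) e₁ _).trans (pairSum_unitPair hk)
  let contract : ExteriorAlgebra ℂ (V × ℂ) →ₗ[ℂ] ExteriorAlgebra ℂ (V × ℂ) :=
    CliffordAlgebra.contractLeft (LinearMap.snd ℂ V ℂ)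
  have hcontract (v x) : contract (ι ℂ v * x) = v.2 • x - ι ℂ v * contract x :=
    CliffordAlgebra.contractLeft_ι_mul _ v x
  refine ⟨formCoeff e₁ (φ ∘ₗ (ExteriorAlgebra.map (LinearMap.fst ℂ V ℂ)).toLinearMap ∘ₗ contract) 1,
    formCoeff_mem he₁_comm _ _, ?_⟩
  rw [diff_formCoeff he₁_comm he₁_self]
  funext T
  refine if_congr Iff.rfl ?_ rfl
  simp only [LinearMap.comp_apply, LinearMap.mulLeft_apply, hcontract, hsnd, one_smul,
    AlgHom.toLinearMap_apply, map_sub, map_mul, map_apply_ι, map_pairSum (LinearMap.fst ℂ V ℂ),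
    map_vertexForm]
  exact sub_eq_self.2 (hfst _)

theorem eq_formCoeff {V : Type*} [AddCommGroup V] [Module ℂ V] {e : Fin k → Fin k → V}
    {φ : ExteriorAlgebra ℂ V →ₗ[ℂ] ℂ} {m : ℕ} {c : Tree (Fin k) → ℂ} (hc : c ∈ BVcoDelta k m)
    (h : ∀ T : Tree (Fin k), T.leaves.Perm (List.finRange k) → T.deltas = m →
      c T = φ (vertexForm e T)) : c = formCoeff e φ m := by
  funext T
  by_cases hT : T.leaves.Perm (List.finRange k) ∧ T.deltas = m
  · rw [formCoeff_of_perm φ hT.1 hT.2, h T hT.1 hT.2]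
  · rw [formCoeff, if_neg hT]
    exact not_not.1 fun h₀ => hT ⟨hc.1.labels T h₀, not_not.1 fun h₁ => h₀ (hc.2 T h₁)⟩

theorem mem_boundaries_of_prods_eq_zero (hk : 2 ≤ k) {c : BVcoDelta k 0}
    (hc : ∀ T, c.1 T ≠ 0 → T.prods = 0) : c ∈ boundaries k := by
  have hK : IsKoszulDual c.1 := c.2.1
  obtain ⟨T₀, h₀, h₀', hp₀⟩ := exists_tree_prods_eq_zero (k := k) (by omega)
  have hform : c.1 = formCoeff (0 : Fin k → Fin k → ℂ) (c.1 T₀ • algebraMapInv.toLinearMap) 0 :=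
    eq_formCoeff c.2 fun T hp hT => by
      by_cases h : T.prods = 0
      · simp [algebraMapInv_vertexForm, h,
          hK.apply_eq_of_prods_eq_zero (by omega) h h₀ hT h₀' hp hp₀]
      · simp [algebraMapInv_vertexForm, h, not_not.1 (mt (hc T) h)]
  have hmem := formCoeff_mem_map_diff hk (e := (0 : Fin k → Fin k → ℂ)) (fun _ _ => rfl)
    (fun _ => rfl) (φ := c.1 T₀ • algebraMapInv.toLinearMap)
    (LinearMap.ext fun x => by simp [algebraMapInv_ι])
  rw [← hform] at hmem
  exact hmem

theorem mem_boundaries_of_prods_eq_one (hk : 2 ≤ k) {c : BVcoDelta k 0}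
    (hc : ∀ T, c.1 T ≠ 0 → T.prods = 1) (h₀ : cogen k c = 0) : c ∈ boundaries k := by
  have hK : IsKoszulDual c.1 := c.2.1
  have hform : c.1 = formCoeff (pairCoeff c.1) ιInv 0 := eq_formCoeff c.2 fun T hp hT => by
    by_cases h : T.prods = 1
    · exact hK.apply_eq_ιInv_vertexForm h hT hp
    · rw [not_not.1 (mt (hc T) h), ιInv_vertexForm_eq_zero _ h]
  have hmem := formCoeff_mem_map_diff hk hK.pairCoeff_comm (pairCoeff_self _) (φ := ιInv) <| by
    rw [← cogen_eq_pairSum, h₀, map_zero, LinearMap.mulLeft_zero_eq_zero, LinearMap.comp_zero]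
  rw [← hform] at hmem
  exact hmem

theorem prods_add_eq_of_homogeneousBrackets {c : BVcoDelta k 0} {ℓ : ℕ}
    (hℓ : HomogeneousBrackets c ℓ) {T : Tree (Fin k)} (hT : c.1 T ≠ 0) : T.prods + ℓ + 1 = k := by
  rw [← hℓ T hT]
  exact prods_add_brks (c.2.1.labels T hT)

theorem cogen_eq_zero_of_mem_higherOps (hk : 0 < k) {c : BVcoDelta k 0}
    (h : (boundaries k).mkQ c ∈ higherOps k) : cogen k c = 0 := by
  obtain ⟨c', hc', hmk⟩ := Submodule.mem_map.1 h
  have hsub := cogen_eq_zero_of_mem_boundaries hk ((Submodule.Quotient.eq _).1 hmk)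
  rwa [map_sub, LinearMap.mem_ker.1 hc', zero_sub, neg_eq_zero] at hsub

theorem brackets_lt_of_mem_higherOps (hk : 2 ≤ k) {c : BVcoDelta k 0} {ℓ : ℕ}
    (hℓ : HomogeneousBrackets c ℓ) (hc : (boundaries k).mkQ c ≠ 0)
    (h : (boundaries k).mkQ c ∈ higherOps k) : (ℓ : ℤ) < (k : ℤ) - 2 := by
  have hc' : c ∉ boundaries k := fun h => hc ((Submodule.Quotient.mk_eq_zero _).2 h)
  have hcount {T} (hT : c.1 T ≠ 0) := prods_add_eq_of_homogeneousBrackets hℓ hT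
  obtain ⟨T, hT⟩ : ∃ T, c.1 T ≠ 0 := by
    by_contra! h₀
    exact hc' ((Subtype.ext (funext h₀) : c = 0) ▸ zero_mem _)
  by_contra! hlt
  obtain hprods | hprods : T.prods = 0 ∨ T.prods = 1 := by
    have := hcount hT
    omega
  · exact hc' (mem_boundaries_of_prods_eq_zero hk fun T' hT' => by grind)
  · exact hc' (mem_boundaries_of_prods_eq_one hk (fun T' hT' => by grind)
      (cogen_eq_zero_of_mem_higherOps (by omega) h))

theorem brackets_eq_of_notMem_higherOps {c : BVcoDelta k 0} {ℓ : ℕ}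
    (hℓ : HomogeneousBrackets c ℓ) (h : (boundaries k).mkQ c ∉ higherOps k) :
    (ℓ : ℤ) = (k : ℤ) - 2 := by
  have h₀ : cogen k c ≠ 0 := fun h₀ => h (Submodule.mem_map.2 ⟨c, h₀, rfl⟩)
  simp only [cogen, LinearMap.comp_apply, LinearMap.sum_apply, LinearMap.proj_apply,
    Submodule.subtype_apply] at h₀
  obtain ⟨i, _, hi⟩ := Finset.exists_ne_zero_of_sum_ne_zero h₀
  obtain ⟨j, _, hij⟩ := Finset.exists_ne_zero_of_sum_ne_zero hi
  have hcount := prods_add_eq_of_homogeneousBrackets hℓ hij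
  simp only [pairTree_eq_comb, prods_comb, Tree.prods, if_true] at hcount
  omega

end Cogenerators

/-! ## The torus action on the fibres -/

theorem theUnique_map {α β F : Type*} [Zero α] [Zero β] [EquivLike F α β] [ZeroHomClass F α β]
    (g : F) {P : α → Prop} {Q : β → Prop} (h : ∀ a, Q (g a) ↔ P a) :
    theUnique Q = g (theUnique P) := by
  have hPQ : (∃! b, Q b) ↔ ∃! a, P a := by
    simp only [(EquivLike.bijective g).existsUnique_iff, h]
  by_cases hP : ∃! a, P a
  · rw [theUnique, theUnique, dif_pos hP, dif_pos (hPQ.2 hP)]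
    exact (hPQ.2 hP).unique (hPQ.2 hP).choose_spec.1 ((h _).2 hP.choose_spec.1)
  · rw [theUnique, theUnique, dif_neg hP, dif_neg (mt hPQ.1 hP), map_zero]

section Functoriality

open ExteriorAlgebra

variable {R V W : Type*} [CommRing R] [AddCommGroup V] [Module R V] [AddCommGroup W] [Module R W]

theorem contractLeft_map (f : V →ₗ[R] W) (d : Module.Dual R W) (x : ExteriorAlgebra R V) :
    CliffordAlgebra.contractLeft (Q := (0 : QuadraticForm R W)) d (map f x) =
      map f (CliffordAlgebra.contractLeft (Q := (0 : QuadraticForm R V)) (d ∘ₗ f) x) := by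
  induction x using CliffordAlgebra.left_induction with
  | algebraMap r =>
    rw [AlgHom.commutes, CliffordAlgebra.contractLeft_algebraMap,
      CliffordAlgebra.contractLeft_algebraMap]
    exact (map_zero (map f)).symm
  | add x y hx hy => simp only [map_add, hx, hy]
  | ι_mul x v hx =>
    change CliffordAlgebra.contractLeft (Q := (0 : QuadraticForm R W)) d (map f (ι R v * x)) = _
    rw [map_mul, map_apply_ι]
    refine (CliffordAlgebra.contractLeft_ι_mul _ _ _).trans ?_
    rw [hx, CliffordAlgebra.contractLeft_ι_mul, map_sub, map_smul]
    refine congrArg (HSub.hSub _) (Eq.symm ?_)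
    exact (map_mul (map f) (ι R v) _).trans (congrArg (· * _) (map_apply_ι f v))

theorem involute_map (f : V →ₗ[R] W) (x : ExteriorAlgebra R V) :
    CliffordAlgebra.involute (map f x) = map f (CliffordAlgebra.involute x) := by
  have h : CliffordAlgebra.involute.comp (map f) = (map f).comp CliffordAlgebra.involute := by
    refine hom_ext (LinearMap.ext fun v => ?_)
    simp only [LinearMap.comp_apply, AlgHom.toLinearMap_apply, AlgHom.comp_apply, map_apply_ι]
    rw [ι, ι, CliffordAlgebra.involute_ι, CliffordAlgebra.involute_ι, map_neg]
    exact congrArg Neg.neg (map_apply_ι f v).symm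
  exact DFunLike.congr_fun h x

theorem algebraMapInv_map (f : V →ₗ[R] W) (x : ExteriorAlgebra R V) :
    algebraMapInv (map f x) = algebraMapInv x := by
  have h : algebraMapInv.comp (map f) = algebraMapInv := by
    refine hom_ext (LinearMap.ext fun v => ?_)
    simp [algebraMapInv]
  exact DFunLike.congr_fun h x

end Functoriality

section Fibre

variable {n : ℕ}

/-- The action of the torus on coefficient vectors, where `(a, b)` multiplies `dz` (or `∂/∂z`) by
`a` and `dz̄` by `b`. -/
def scaleCoef (n : ℕ) (a b : Circle) : Coef n →ₗ[ℂ] Coef n :=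
  LinearMap.prodMap ((b : ℂ) • LinearMap.id) ((a : ℂ) • LinearMap.id)

theorem scaleCoef_apply (a b : Circle) (m : Coef n) :
    scaleCoef n a b m = ((b : ℂ) • m.1, (a : ℂ) • m.2) := rfl

theorem scaleCoef_injective (a b : Circle) : Function.Injective (scaleCoef n a b) :=
  (smul_right_injective _ (Circle.coe_ne_zero b)).prodMap
    (smul_right_injective _ (Circle.coe_ne_zero a))

/-- The algebra endomorphism of the fibre induced by `scaleCoef`. -/
def scaleFib (n : ℕ) (a b : Circle) : Fib n →ₐ[ℂ] Fib n := ExteriorAlgebra.map (scaleCoef n a b)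

theorem scaleFib_ι (a b : Circle) (m : Coef n) :
    scaleFib n a b (ExteriorAlgebra.ι ℂ m) =
      ExteriorAlgebra.ι ℂ ((b : ℂ) • m.1, (a : ℂ) • m.2) := ExteriorAlgebra.map_apply_ι _ _

theorem scaleFib_ι_inl (a b : Circle) (v : Fin n → ℂ) :
    scaleFib n a b (ExteriorAlgebra.ι ℂ (v, 0)) = (b : ℂ) • ExteriorAlgebra.ι ℂ (v, 0) := by
  simp [scaleFib_ι, ← map_smul]

theorem scaleFib_ι_inr (a b : Circle) (v : Fin n → ℂ) :
    scaleFib n a b (ExteriorAlgebra.ι ℂ (0, v)) = (a : ℂ) • ExteriorAlgebra.ι ℂ (0, v) := by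
  simp [scaleFib_ι, ← map_smul]

instance : FiniteDimensional ℂ (Fib n) := (fibCoord n).symm.finiteDimensional

/-- The composition of `scaleFib` with the multiplication by `c`. The extra scalar makes it
possible to state that an operator is equivariant up to a character. -/
def twistFib (n : ℕ) (c a b : Circle) : Fib n ≃L[ℂ] Fib n :=
  (LinearEquiv.ofInjectiveEndo ((c : ℂ) • (scaleFib n a b).toLinearMap)
    ((smul_right_injective _ (Circle.coe_ne_zero c)).comp
      (ExteriorAlgebra.map_injective_field
        (LinearMap.ker_eq_bot.2 (scaleCoef_injective a b))))).toContinuousLinearEquiv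

theorem twistFib_apply (c a b : Circle) (x : Fib n) :
    twistFib n c a b x = (c : ℂ) • scaleFib n a b x := rfl

theorem twistFib_mul (c c' a b : Circle) (x y : Fib n) :
    twistFib n c a b x * twistFib n c' a b y = twistFib n (c * c') a b (x * y) := by
  simp only [twistFib_apply, map_mul, smul_mul_smul_comm, Circle.coe_mul]

theorem dzbar_mul_twistFib (i : Fin n) (c a b : Circle) (x : Fib n) :
    dzbar i * twistFib n c a b x = twistFib n (c / b) a b (dzbar i * x) := by
  simp [twistFib_apply, dzbar, scaleFib_ι_inl, smul_smul]

theorem dz_mul_twistFib (i : Fin n) (c a b : Circle) (x : Fib n) :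
    dz i * twistFib n c a b x = twistFib n (c / a) a b (dz i * x) := by
  simp [twistFib_apply, dz, scaleFib_ι_inr, smul_smul]

theorem involute_twistFib (c a b : Circle) (x : Fib n) :
    CliffordAlgebra.involute (twistFib n c a b x) =
      twistFib n c a b (CliffordAlgebra.involute x) := by
  rw [twistFib_apply, map_smul, scaleFib, involute_map, twistFib_apply, scaleFib]

theorem contractLeft_twistFib {d : Module.Dual ℂ (Coef n)} {a b z : Circle}
    (hd : d ∘ₗ scaleCoef n a b = (z : ℂ) • d) (c : Circle) (x : Fib n) :
    CliffordAlgebra.contractLeft (Q := 0) d (twistFib n c a b x) =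
      twistFib n (c * z) a b (CliffordAlgebra.contractLeft (Q := 0) d x) := by
  rw [twistFib_apply, map_smul, scaleFib, contractLeft_map, hd, map_smul, LinearMap.smul_apply,
    map_smul, smul_smul, twistFib_apply, Circle.coe_mul, scaleFib]

theorem contr_twistFib (v : Fin n → ℂ) (c a b : Circle) (x : Fib n) :
    contr v (twistFib n c a b x) = twistFib n (c * a) a b (contr v x) :=
  contractLeft_twistFib (LinearMap.ext fun m => by
    simp only [LinearMap.comp_apply, LinearMap.smul_apply, LinearMap.snd_apply, scaleCoef_apply,
      map_smul]) c x

theorem contrBar_twistFib (v : Fin n → ℂ) (c a b : Circle) (x : Fib n) :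
    contrBar v (twistFib n c a b x) = twistFib n (c * b) a b (contrBar v x) :=
  contractLeft_twistFib (LinearMap.ext fun m => by
    simp only [LinearMap.comp_apply, LinearMap.smul_apply, LinearMap.fst_apply, scaleCoef_apply,
      map_smul]) c x

theorem foldr_twistFib {T : Fin n → Module.End ℂ (Fib n)} {a b z : Circle}
    (hT : ∀ i c x, T i (twistFib n c a b x) = twistFib n (c * z) a b (T i x)) (l : List (Fin n))
    (c : Circle) (x : Fib n) :
    l.foldr (fun i y => T i y) (twistFib n c a b x) =
      twistFib n (c * z ^ l.length) a b (l.foldr (fun i y => T i y) x) := by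
  induction l with
  | nil => simp
  | cons i l ih => rw [List.foldr_cons, ih, hT, List.foldr_cons, List.length_cons, pow_succ,
      mul_assoc]

theorem formComp_twistFib (f : Fin n → Fin n → ℂ) (I J : Finset (Fin n)) (c a b : Circle)
    (x : Fib n) : formComp f I J (twistFib n c a b x) =
      ((c * a ^ I.card * b ^ J.card : Circle) : ℂ) * formComp f I J x := by
  rw [formComp, foldr_twistFib (T := fun i => contr (f i)) fun i c => contr_twistFib (f i) c a b,
    foldr_twistFib (T := fun i => contrBar (f i)) fun i c => contrBar_twistFib (f i) c a b,
    twistFib_apply, map_smul, scaleFib, algebraMapInv_map, Finset.length_sort, Finset.length_sort,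
    smul_eq_mul, formComp]

theorem contr_smul (z : ℂ) (v : Fin n → ℂ) : contr (z • v) = z • contr v := by
  have h : Fintype.linearCombination ℂ (z • v) = z • Fintype.linearCombination ℂ v := by
    ext
    simp [mul_left_comm]
  rw [contr, h, LinearMap.smul_comp, map_smul, contr]

theorem polyAction_ι (m : Coef n) (σ : Fib n) :
    polyAction n (ExteriorAlgebra.ι ℂ m) σ =
      ExteriorAlgebra.ι ℂ (m.1, (0 : Fin n → ℂ)) * σ + contr m.2 σ := by
  rw [polyAction, ExteriorAlgebra.lift_ι_apply]
  rfl

theorem polyAction_scaleFib (c a b : Circle) (s σ : Fib n) :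
    polyAction n (scaleFib n a b s) (twistFib n c a⁻¹ b σ) =
      twistFib n c a⁻¹ b (polyAction n s σ) := by
  induction s using ExteriorAlgebra.induction generalizing σ with
  | algebraMap r => simp [Module.algebraMap_end_apply]
  | ι m =>
    rw [scaleFib_ι, polyAction_ι, polyAction_ι, contr_smul, LinearMap.smul_apply, contr_twistFib,
      map_add]
    simp [twistFib_apply, scaleFib_ι, smul_smul, mul_left_comm, Circle.coe_ne_zero]
  | mul x y hx hy => simp only [map_mul, Module.End.mul_apply, hx, hy]
  | add x y hx hy => simp only [map_add, LinearMap.add_apply, hx, hy]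

theorem polyAction_twistFib (c c' a b : Circle) (s σ : Fib n) :
    polyAction n (twistFib n c a b s) (twistFib n c' a⁻¹ b σ) =
      twistFib n (c * c') a⁻¹ b (polyAction n s σ) := by
  rw [twistFib_apply c, map_smul, LinearMap.smul_apply, polyAction_scaleFib, twistFib_apply,
    twistFib_apply, smul_smul, Circle.coe_mul]

end Fibre

/-! ## Bidegrees as weights -/

/-- The character of the torus by which it acts on `bideg n p q`. -/
def weight (p q : ℤ) (a b : Circle) : Circle := a ^ p * b ^ q

theorem weight_add (p q p' q' : ℤ) (a b : Circle) :
    weight (p + p') (q + q') a b = weight p q a b * weight p' q' a b := by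
  rw [weight, weight, weight, zpow_add, zpow_add, mul_mul_mul_comm]

theorem exists_zpow_ne_one {m : ℤ} (hm : m ≠ 0) : ∃ a : Circle, a ^ m ≠ 1 := by
  refine ⟨Circle.exp (Real.pi / m), ?_⟩
  have hm' : (m : ℝ) ≠ 0 := Int.cast_ne_zero.2 hm
  rw [← Circle.exp_intCast_mul, mul_div_cancel₀ _ hm']
  exact Circle.exp_pi_ne_one

theorem weight_injective :
    Function.Injective fun (d : ℤ × ℤ) (t : Circle × Circle) => (weight d.1 d.2 t.1 t.2 : ℂ) := by
  have zpow_injective : ∀ m m' : ℤ, (∀ a : Circle, a ^ m = a ^ m') → m = m' := by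
    intro m m' h
    by_contra hne
    obtain ⟨a, ha⟩ := exists_zpow_ne_one (sub_ne_zero.2 hne)
    exact ha (by rw [zpow_sub, h a, mul_inv_cancel])
  intro d d' h
  have h' : ∀ a b, weight d.1 d.2 a b = weight d'.1 d'.2 a b := fun a b =>
    Circle.ext (congrFun h (a, b))
  exact Prod.ext (zpow_injective _ _ fun a => by simpa [weight] using h' a 1)
    (zpow_injective _ _ fun b => by simpa [weight] using h' 1 b)

section Eigenspaces

open Module

variable {R A : Type*} [CommRing R] [Ring A] [Algebra R A]

theorem eigenspace_mul_le (f : A →ₐ[R] A) (r s : R) :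
    End.eigenspace f.toLinearMap r * End.eigenspace f.toLinearMap s ≤
      End.eigenspace f.toLinearMap (r * s) := by
  refine Submodule.mul_le.2 fun x hx y hy => ?_
  rw [End.mem_eigenspace_iff, AlgHom.toLinearMap_apply] at hx hy ⊢
  rw [map_mul, hx, hy, smul_mul_smul_comm]

theorem pow_le_eigenspace (f : A →ₐ[R] A) {S : Submodule R A} {r : R}
    (hS : S ≤ End.eigenspace f.toLinearMap r) (m : ℕ) :
    S ^ m ≤ End.eigenspace f.toLinearMap (r ^ m) := by
  induction m with
  | zero =>
    rw [pow_zero, pow_zero, Submodule.one_le, End.mem_eigenspace_iff,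
      AlgHom.toLinearMap_apply, map_one, one_smul]
  | succ m ih =>
    rw [pow_succ, pow_succ]
    exact (mul_le_mul' ih hS).trans (eigenspace_mul_le f _ _)

theorem eq_iInf_eigenspace_of_iSup_eq_top {K V ι κ : Type*} [Field K] [AddCommGroup V]
    [Module K V] {f : ι → End K V} (hf : ∀ i j, Commute (f i) (f j)) {χ : κ → ι → K}
    (hχ : Function.Injective χ) {S : κ → Submodule K V}
    (hle : ∀ d i, S d ≤ (f i).eigenspace (χ d i)) (hS : ⨆ d, S d = ⊤) (d : κ) :
    S d = ⨅ i, (f i).eigenspace (χ d i) := by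
  have indep : iSupIndep fun d => ⨅ i, (f i).eigenspace (χ d i) :=
    ((End.independent_iInf_maxGenEigenspace_of_forall_mapsTo f fun i j =>
      End.mapsTo_maxGenEigenspace_of_comm (hf j i)).comp hχ).mono
        fun d => iInf_mono fun i => (f i).eigenspace_le_maxGenEigenspace
  exact congrFun ((indep.le_iff_eq_of_iSup_eq_top hS).1 fun d => le_iInf (hle d)) d

end Eigenspaces

section Fibre

variable {n : ℕ}

theorem scaleFib_scaleFib (a b a' b' : Circle) (x : Fib n) :
    scaleFib n a b (scaleFib n a' b' x) = scaleFib n (a * a') (b * b') x := by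
  have h : (scaleFib n a b).comp (scaleFib n a' b') = scaleFib n (a * a') (b * b') :=
    ExteriorAlgebra.hom_ext (LinearMap.ext fun m => by
      simp [scaleFib_ι, smul_smul])
  exact DFunLike.congr_fun h x

theorem scaleFib_of_mem_bideg {p q : ℤ} {x : Fib n} (hx : x ∈ bideg n p q) (a b : Circle) :
    scaleFib n a b x = (weight p q a b : ℂ) • x := by
  rw [bideg] at hx
  split_ifs at hx with hpq
  · lift p to ℕ using hpq.1
    lift q to ℕ using hpq.2
    have hdz : LinearMap.range (ExteriorAlgebra.ι ℂ ∘ₗ LinearMap.inr ℂ (Fin n → ℂ) (Fin n → ℂ)) ≤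
        Module.End.eigenspace (scaleFib n a b).toLinearMap (a : ℂ) := by
      rintro _ ⟨v, rfl⟩
      exact Module.End.mem_eigenspace_iff.2 (scaleFib_ι_inr a b v)
    have hdzbar :
        LinearMap.range (ExteriorAlgebra.ι ℂ ∘ₗ LinearMap.inl ℂ (Fin n → ℂ) (Fin n → ℂ)) ≤
          Module.End.eigenspace (scaleFib n a b).toLinearMap (b : ℂ) := by
      rintro _ ⟨v, rfl⟩
      exact Module.End.mem_eigenspace_iff.2 (scaleFib_ι_inl a b v)
    have h := eigenspace_mul_le _ _ _
      (mul_le_mul' (pow_le_eigenspace _ hdz _) (pow_le_eigenspace _ hdzbar _) hx)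
    simpa [weight] using Module.End.mem_eigenspace_iff.1 h
  · rw [(Submodule.mem_bot ℂ).1 hx, map_zero, smul_zero]

theorem ι_inr_mul_mem_bideg (v : Fin n → ℂ) {p q : ℤ} {x : Fib n} (hx : x ∈ bideg n p q) :
    ExteriorAlgebra.ι ℂ ((0 : Fin n → ℂ), v) * x ∈ bideg n (p + 1) q := by
  rw [bideg] at hx
  split_ifs at hx with hpq
  · lift p to ℕ using hpq.1
    rw [bideg, if_pos ⟨by lia, hpq.2⟩, Int.toNat_natCast_add_one, pow_succ', mul_assoc]
    exact Submodule.mul_mem_mul ⟨v, rfl⟩ hx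
  · rw [(Submodule.mem_bot ℂ).1 hx, mul_zero]
    exact zero_mem _

theorem commute_range_ι (L L' : (Fin n → ℂ) →ₗ[ℂ] Coef n) :
    Commute (LinearMap.range (ExteriorAlgebra.ι ℂ ∘ₗ L))
      (LinearMap.range (ExteriorAlgebra.ι ℂ ∘ₗ L')) := by
  refine le_antisymm (Submodule.mul_le.2 ?_) (Submodule.mul_le.2 ?_) <;>
  · rintro _ ⟨u, rfl⟩ _ ⟨v, rfl⟩
    rw [LinearMap.comp_apply, LinearMap.comp_apply, ι_mul_ι_comm]
    exact neg_mem (Submodule.mul_mem_mul ⟨v, rfl⟩ ⟨u, rfl⟩)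

theorem ι_inl_mul_mem_bideg (v : Fin n → ℂ) {p q : ℤ} {x : Fib n} (hx : x ∈ bideg n p q) :
    ExteriorAlgebra.ι ℂ (v, (0 : Fin n → ℂ)) * x ∈ bideg n p (q + 1) := by
  rw [bideg] at hx
  split_ifs at hx with hpq
  · lift q to ℕ using hpq.2
    rw [bideg, if_pos ⟨hpq.1, by lia⟩, Int.toNat_natCast_add_one, pow_succ', ← mul_assoc,
      ← ((commute_range_ι _ _).pow_right _).eq, mul_assoc]
    exact Submodule.mul_mem_mul ⟨v, rfl⟩ hx
  · rw [(Submodule.mem_bot ℂ).1 hx, mul_zero]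
    exact zero_mem _

theorem iSup_bideg (n : ℕ) : ⨆ d : ℤ × ℤ, bideg n d.1 d.2 = ⊤ := by
  have ι_mul_mem (m : Coef n) {x : Fib n} (hx : x ∈ ⨆ d : ℤ × ℤ, bideg n d.1 d.2) :
      ExteriorAlgebra.ι ℂ m * x ∈ ⨆ d : ℤ × ℤ, bideg n d.1 d.2 := by
    induction hx using Submodule.iSup_induction' with
    | zero => rw [mul_zero]; exact zero_mem _
    | add x y _ _ hx hy => rw [mul_add]; exact add_mem hx hy
    | mem d x hx =>
      have hm : m = (0, m.2) + (m.1, 0) := by simp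
      rw [hm, map_add, add_mul]
      exact add_mem (Submodule.mem_iSup_of_mem (d.1 + 1, d.2) (ι_inr_mul_mem_bideg m.2 hx))
        (Submodule.mem_iSup_of_mem (d.1, d.2 + 1) (ι_inl_mul_mem_bideg m.1 hx))
  refine eq_top_iff.2 fun x _ => ?_
  induction x using CliffordAlgebra.left_induction with
  | algebraMap r =>
    refine Submodule.mem_iSup_of_mem (0, 0) ?_
    simp [bideg]
  | add x y hx hy => exact add_mem (hx trivial) (hy trivial)
  | ι_mul x m hx => exact ι_mul_mem m (hx trivial)

theorem bideg_eq_iInf_eigenspace (p q : ℤ) : bideg n p q =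
    ⨅ t : Circle × Circle,
      Module.End.eigenspace (scaleFib n t.1 t.2).toLinearMap (weight p q t.1 t.2 : ℂ) :=
  eq_iInf_eigenspace_of_iSup_eq_top (S := fun d : ℤ × ℤ => bideg n d.1 d.2)
    (f := fun t : Circle × Circle => (scaleFib n t.1 t.2).toLinearMap)
    (fun t t' => LinearMap.ext fun x => by
      simp only [Module.End.mul_apply, AlgHom.toLinearMap_apply, scaleFib_scaleFib, mul_comm])
    weight_injective
    (fun _ t _ hx => Module.End.mem_eigenspace_iff.2 (scaleFib_of_mem_bideg hx t.1 t.2))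
    (iSup_bideg n) (p, q)

theorem mem_bideg_iff {p q : ℤ} {x : Fib n} :
    x ∈ bideg n p q ↔ ∀ a b, twistFib n (weight p q a b)⁻¹ a b x = x := by
  simp only [bideg_eq_iInf_eigenspace, Submodule.mem_iInf, Prod.forall,
    Module.End.mem_eigenspace_iff, AlgHom.toLinearMap_apply, twistFib_apply, Circle.coe_inv,
    inv_smul_eq_iff₀ (Circle.coe_ne_zero _)]

end Fibre

/-! ## Bihomogeneous operators -/

section Manifold

variable {n : ℕ} {M : Type*}

variable (M) in
/-- The action of `twistFib` on sections. -/
def twist (c a b : Circle) : (M → Fib n) ≃ₗ[ℂ] (M → Fib n) :=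
  LinearEquiv.piCongrRight fun _ => (twistFib n c a b).toLinearEquiv

theorem twist_apply (c a b : Circle) (s : M → Fib n) (x : M) :
    twist M c a b s x = twistFib n c a b (s x) := rfl

theorem twist_mul (c c' a b : Circle) (s t : M → Fib n) :
    twist M c a b s * twist M c' a b t = twist M (c * c') a b (s * t) :=
  funext fun _ => twistFib_mul _ _ _ _ _ _

variable (n M) in
/-- The sections that have bidegree `(p, q)` at every point. -/
def bidegSections (p q : ℤ) : Submodule ℂ (M → Fib n) :=
  Submodule.pi Set.univ fun _ => bideg n p q

theorem mem_bidegSections_iff {p q : ℤ} {s : M → Fib n} :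
    s ∈ bidegSections n M p q ↔ ∀ a b, twist M (weight p q a b)⁻¹ a b s = s := by
  simp only [bidegSections, Submodule.mem_pi, Set.mem_univ, true_implies, mem_bideg_iff,
    funext_iff, twist_apply]
  exact ⟨fun h a b x => h x a b, fun h x a b => h a b x⟩

theorem mul_mem_bidegSections {p q p' q' : ℤ} {s t : M → Fib n} (hs : s ∈ bidegSections n M p q)
    (ht : t ∈ bidegSections n M p' q') : s * t ∈ bidegSections n M (p + p') (q + q') := by
  rw [mem_bidegSections_iff] at hs ht ⊢
  intro a b
  rw [weight_add, mul_inv, ← twist_mul, hs, ht]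

/-- An operator on sections that is equivariant for the torus action up to the character
`weight i j`, and therefore has bidegree `(i, j)`. -/
def IsBihomogeneous (i j : ℤ) (F : (M → Fib n) → (M → Fib n)) : Prop :=
  ∀ c a b s, F (twist M c a b s) = twist M (c / weight i j a b) a b (F s)

namespace IsBihomogeneous

variable {F G : (M → Fib n) → (M → Fib n)} {i j i' j' : ℤ}

theorem comp (hF : IsBihomogeneous i j F) (hG : IsBihomogeneous i' j' G) :
    IsBihomogeneous (i + i') (j + j') (F ∘ G) := fun c a b s => by
  rw [Function.comp_apply, hG, hF, weight_add, div_div, mul_comm (weight i' j' a b),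
    Function.comp_apply]

theorem add (hF : IsBihomogeneous i j F) (hG : IsBihomogeneous i j G) :
    IsBihomogeneous i j (F + G) := fun c a b s => by
  rw [Pi.add_apply, hF, hG, ← map_add, Pi.add_apply]

theorem map_mem (hF : IsBihomogeneous i j F) {p q : ℤ} {s : M → Fib n}
    (hs : s ∈ bidegSections n M p q) : F s ∈ bidegSections n M (p + i) (q + j) := by
  rw [mem_bidegSections_iff] at hs ⊢
  intro a b
  rw [weight_add, mul_inv, ← div_eq_mul_inv, ← hF, hs]

theorem map_twist (hF : IsBihomogeneous 0 0 F) (c a b : Circle) (s : M → Fib n) :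
    F (twist M c a b s) = twist M c a b (F s) := by
  simpa [weight] using hF c a b s

theorem iterate (hF : IsBihomogeneous 0 0 F) (m : ℕ) : IsBihomogeneous 0 0 F^[m] := by
  induction m with
  | zero => exact fun c a b s => by simp [weight]
  | succ m ih => simpa only [Function.iterate_succ, add_zero] using ih.comp hF

end IsBihomogeneous

theorem isBihomogeneous_par : IsBihomogeneous 0 0 (par : (M → Fib n) → (M → Fib n)) :=
  fun c a b s => by
    funext x
    simp [par, twist_apply, involute_twistFib, weight]

theorem parityPart_mem_bidegSections {p q : ℤ} {s : M → Fib n} (hs : s ∈ bidegSections n M p q)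
    (e : Fin 2) : parityPart e s ∈ bidegSections n M p q := by
  have hpar : par s ∈ bidegSections n M p q := by simpa using isBihomogeneous_par.map_mem hs
  exact Submodule.smul_mem _ _ (add_mem hs (Submodule.smul_mem _ _ hpar))

theorem fderiv_continuousLinearEquiv_comp {E F : Type*} [NormedAddCommGroup E]
    [NormedSpace ℝ E] [NormedAddCommGroup F] [NormedSpace ℂ F] (L : F ≃L[ℂ] F) (f : E → F)
    (u v : E) :
    fderiv ℝ (L ∘ f) u v = L (fderiv ℝ f u v) :=
  DFunLike.congr_fun ((L.restrictScalars ℝ).comp_fderiv (f := f) (x := u)) v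

theorem wirtBar_comp (L : Fib n ≃L[ℂ] Fib n) (i : Fin n) (f : Cn n → Fib n) (u : Cn n) :
    wirtBar i (L ∘ f) u = L (wirtBar i f u) := by
  simp only [wirtBar, fderiv_continuousLinearEquiv_comp, map_smul, map_add]

theorem wirt_comp (L : Fib n ≃L[ℂ] Fib n) (i : Fin n) (f : Cn n → Fib n) (u : Cn n) :
    wirt i (L ∘ f) u = L (wirt i f u) := by
  simp only [wirt, fderiv_continuousLinearEquiv_comp, map_smul, map_sub]

variable [TopologicalSpace M] [ChartedSpace (Cn n) M]

theorem localRep_twist {tr : M → M → (Coef n →ₗ[ℂ] Coef n)} {a b : Circle}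
    (htr : ∀ x y, tr x y ∘ₗ scaleCoef n a b = scaleCoef n a b ∘ₗ tr x y)
    (c : Circle) (s : M → Fib n) (x : M) :
    localRep tr (twist M c a b s) x = twistFib n c a b ∘ localRep tr s x := by
  have map_scaleFib (y : M) (σ : Fib n) : ExteriorAlgebra.map (tr x y) (scaleFib n a b σ) =
      scaleFib n a b (ExteriorAlgebra.map (tr x y) σ) := by
    simp only [scaleFib, ← AlgHom.comp_apply, ExteriorAlgebra.map_comp_map, htr]
  funext u
  simp only [localRep, twist_apply, twistFib_apply, Function.comp_apply, map_smul, map_scaleFib]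

variable [IsManifold 𝓘(ℂ, Cn n) ω M]

theorem polyTrans_comp_scaleCoef (x y : M) (a b : Circle) :
    polyTrans x y ∘ₗ scaleCoef n a b = scaleCoef n a b ∘ₗ polyTrans x y :=
  LinearMap.ext fun m => by
    simp only [polyTrans, LinearMap.comp_apply, scaleCoef_apply, LinearMap.prodMap_apply, map_smul]

theorem formTrans_comp_scaleCoef (x y : M) (a b : Circle) :
    formTrans x y ∘ₗ scaleCoef n a b = scaleCoef n a b ∘ₗ formTrans x y :=
  LinearMap.ext fun m => by
    simp only [formTrans, LinearMap.comp_apply, scaleCoef_apply, LinearMap.prodMap_apply, map_smul]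

theorem localRep_polyTrans_twist (c a b : Circle) (s : M → Fib n) (x : M) :
    localRep polyTrans (twist M c a b s) x = twistFib n c a b ∘ localRep polyTrans s x :=
  localRep_twist (fun x y => polyTrans_comp_scaleCoef x y a b) c s x

theorem isBihomogeneous_dbar : IsBihomogeneous 0 1 (dbar : (M → Fib n) → (M → Fib n)) :=
  fun c a b s => by
    funext x
    simp only [dbar, dbarOp, localRep_polyTrans_twist, wirtBar_comp, dzbar_mul_twistFib,
      twist_apply, map_sum, weight, zpow_zero, one_mul, zpow_one]

theorem isBihomogeneous_delForm : IsBihomogeneous 1 0 (delForm : (M → Fib n) → (M → Fib n)) :=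
  fun c a b s => by
    funext x
    simp only [delForm, localRep_twist fun x y => formTrans_comp_scaleCoef x y a b, wirt_comp,
      dz_mul_twistFib, twist_apply, map_sum, weight, zpow_zero, mul_one, zpow_one]

theorem twist_mem_B_iff (c a b : Circle) (s : M → Fib n) :
    twist M c a b s ∈ B n M ↔ s ∈ B n M := by
  refine forall_congr' fun x => ?_
  rw [localRep_polyTrans_twist]
  exact ((twistFib n c a b).restrictScalars ℝ).comp_contDiffOn_iff

theorem mem_cocycles_iff {s : M → Fib n} : s ∈ cocycles n M ↔ s ∈ B n M ∧ dbar s = 0 := by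
  constructor
  · rintro ⟨t, ht, rfl⟩
    exact ⟨t.2, ht⟩
  · rintro ⟨hs, hs'⟩
    exact ⟨⟨s, hs⟩, hs', rfl⟩

theorem twist_mem_cocycles_iff (c a b : Circle) (s : M → Fib n) :
    twist M c a b s ∈ cocycles n M ↔ s ∈ cocycles n M := by
  rw [mem_cocycles_iff, mem_cocycles_iff, twist_mem_B_iff, isBihomogeneous_dbar,
    LinearEquiv.map_eq_zero_iff]

theorem cls_eq_cls_iff {s t : M → Fib n} (hs : s ∈ cocycles n M) (ht : t ∈ cocycles n M) :
    cls s = cls t ↔ ∃ r ∈ B n M, dbar r = s - t := by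
  rw [cls, cls, dif_pos hs, dif_pos ht, Submodule.Quotient.eq]
  exact ⟨fun ⟨r, hr⟩ => ⟨r, r.2, hr⟩, fun ⟨r, hr, h⟩ => ⟨⟨r, hr⟩, h⟩⟩

theorem cls_twist_eq_cls_twist_iff {s t : M → Fib n} (hs : s ∈ cocycles n M)
    (ht : t ∈ cocycles n M) (c a b : Circle) :
    cls (twist M c a b s) = cls (twist M c a b t) ↔ cls s = cls t := by
  rw [cls_eq_cls_iff ((twist_mem_cocycles_iff c a b s).2 hs)
    ((twist_mem_cocycles_iff c a b t).2 ht), cls_eq_cls_iff hs ht,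
    (twist M (c * weight 0 1 a b) a b).surjective.exists]
  simp only [twist_mem_B_iff, isBihomogeneous_dbar _ _ _ _, mul_div_cancel_right, ← map_sub,
    (twist M c a b).injective.eq_iff]

theorem mem_cohBideg_iff {p q : ℤ} {z : H n M} :
    z ∈ cohBideg p q ↔ ∃ s ∈ cocycles n M, s ∈ bidegSections n M p q ∧ cls s = z := by
  constructor
  · rintro ⟨s, hs, rfl⟩
    exact ⟨s, s.2, hs, dif_pos s.2⟩
  · rintro ⟨s, hs, hs', rfl⟩
    exact ⟨⟨s, hs⟩, hs', by rw [cls, dif_pos hs]; rfl⟩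

namespace CalabiYau

variable (X : CalabiYau n M)

theorem twistFib_vol (a b : Circle) (x : M) :
    twistFib n (weight n 0 a b) a⁻¹ b (X.vol x) = X.vol x := by
  have h := mem_bideg_iff.1 (X.vol_mem x) a⁻¹ b
  simpa [weight] using h

theorem bigstar_twistFib (c a b : Circle) (x : M) (s : Fib n) :
    X.bigstar x (twistFib n c a b s) =
      twistFib n (c * weight n 0 a b) a⁻¹ b (X.bigstar x s) := by
  rw [bigstar, bigstar, ← polyAction_twistFib, X.twistFib_vol]

theorem bigstarInv_twistFib (c a b : Circle) (x : M) (σ : Fib n) :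
    X.bigstarInv x (twistFib n (c * weight n 0 a b) a⁻¹ b σ) =
      twistFib n c a b (X.bigstarInv x σ) :=
  theUnique_map (twistFib n c a b) fun s => by
    rw [bigstar_twistFib, (twistFib n _ a⁻¹ b).injective.eq_iff]

theorem isBihomogeneous_bv : IsBihomogeneous (-1) 0 X.bv := fun c a b s => by
  funext x
  have h : (fun y => X.bigstar y (twist M c a b s y)) =
      twist M (c * weight n 0 a b) a⁻¹ b (fun y => X.bigstar y (s y)) :=
    funext fun y => X.bigstar_twistFib c a b y (s y)
  have hw : c * weight n 0 a b / weight 1 0 a⁻¹ b = c / weight (-1) 0 a b * weight n 0 a b := by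
    simp [weight, mul_right_comm]
  rw [bv, h, isBihomogeneous_delForm, twist_apply, hw, bigstarInv_twistFib, twist_apply, bv]

theorem bracket_mem_bidegSections {p q p' q' : ℤ} {s t : M → Fib n}
    (hs : s ∈ bidegSections n M p q) (ht : t ∈ bidegSections n M p' q') :
    X.bracket s t ∈ bidegSections n M (p + p' - 1) (q + q') := by
  have hpar : par s ∈ bidegSections n M p q := by simpa using isBihomogeneous_par.map_mem hs
  have h₁ := X.isBihomogeneous_bv.map_mem (mul_mem_bidegSections hs ht)
  have h₂ := mul_mem_bidegSections (X.isBihomogeneous_bv.map_mem hs) ht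
  have h₃ := mul_mem_bidegSections hpar (X.isBihomogeneous_bv.map_mem ht)
  rw [add_zero, ← sub_eq_add_neg] at h₁
  rw [add_zero, add_right_comm, ← sub_eq_add_neg] at h₂
  rw [add_zero, ← add_assoc, ← sub_eq_add_neg] at h₃
  exact sub_mem (sub_mem h₁ h₂) h₃

theorem binary_mem_bidegSections (d : Dec) {p q p' q' : ℤ} {s t : M → Fib n}
    (hs : s ∈ bidegSections n M p q) (ht : t ∈ bidegSections n M p' q') :
    X.binary d s t ∈ bidegSections n M (p + p' - if d = Dec.brk then 1 else 0) (q + q') := by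
  cases d
  · simpa [binary] using mul_mem_bidegSections hs ht
  · simpa [binary] using X.bracket_mem_bidegSections hs ht

theorem formInner_twistFib (c a b : Circle) (x : M) (σ τ : Fib n) :
    X.formInner x (twistFib n c a b σ) (twistFib n c a b τ) = X.formInner x σ τ := by
  have mul_conj_mul (z : Circle) (u v : ℂ) : z * u * conj (z * v) = u * conj v := by
    rw [map_mul, mul_mul_mul_comm, Complex.mul_conj, Circle.normSq_coe, Complex.ofReal_one,
      one_mul]
  simp only [formInner, formComp_twistFib, mul_conj_mul]

variable [MeasurableSpace M]

theorem inner_twist (c a b : Circle) (s t : M → Fib n) :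
    X.inner (twist M c a b s) (twist M c a b t) = X.inner s t := by
  simp only [inner, twist_apply, bigstar_twistFib, formInner_twistFib]

theorem isBihomogeneous_dbarAdj : IsBihomogeneous 0 (-1) X.dbarAdj := fun c a b s =>
  theUnique_map (twist M (c / weight 0 (-1) a b) a b) fun t => by
    have dbar_twist (r : M → Fib n) : dbar (twist M (c / weight 0 (-1) a b) a b r) =
        twist M c a b (dbar r) := by
      rw [isBihomogeneous_dbar, div_div, ← weight_add]
      simp [weight]
    rw [(twist M (c / weight 0 (-1) a b) a b).surjective.forall]
    simp only [twist_mem_B_iff, dbar_twist, inner_twist]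

theorem isBihomogeneous_laplacian : IsBihomogeneous 0 0 X.laplacian := by
  have h₁ := isBihomogeneous_dbar.comp X.isBihomogeneous_dbarAdj
  have h₂ := X.isBihomogeneous_dbarAdj.comp isBihomogeneous_dbar
  rw [add_zero, add_neg_cancel] at h₁
  rw [add_zero, neg_add_cancel] at h₂
  exact h₁.add h₂

theorem isHarmonic_twist_iff (c a b : Circle) (s : M → Fib n) :
    X.IsHarmonic (twist M c a b s) ↔ X.IsHarmonic s := by
  rw [IsHarmonic, IsHarmonic, twist_mem_cocycles_iff, X.isBihomogeneous_dbarAdj,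
    LinearEquiv.map_eq_zero_iff]

theorem isBihomogeneous_harmProj : IsBihomogeneous 0 0 X.harmProj := fun c a b s => by
  have hc : c / weight 0 0 a b = c := by simp [weight]
  rw [hc]
  refine theUnique_map (twist M c a b) fun t => ?_
  rw [(twist M c a b).surjective.forall]
  simp only [isHarmonic_twist_iff, inner_twist]

theorem isBihomogeneous_green : IsBihomogeneous 0 0 X.green := fun c a b s => by
  have hc : c / weight 0 0 a b = c := by simp [weight]
  rw [hc]
  refine theUnique_map (twist M c a b) fun t => ?_
  rw [(twist M c a b).surjective.forall, X.isBihomogeneous_laplacian.map_twist,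
    X.isBihomogeneous_harmProj.map_twist, ← map_sub, (twist M c a b).injective.eq_iff]
  simp only [twist_mem_B_iff, isHarmonic_twist_iff, inner_twist]

theorem isBihomogeneous_htpy : IsBihomogeneous 0 (-1) X.htpy := by
  have h := X.isBihomogeneous_dbarAdj.comp X.isBihomogeneous_green
  rwa [add_zero, add_zero] at h

theorem incl_mem_bidegSections {p q : ℤ} {z : H n M} (hz : z ∈ cohBideg p q) :
    X.incl z ∈ bidegSections n M p q := by
  obtain ⟨s, hs, hpq, rfl⟩ := mem_cohBideg_iff.1 hz
  rw [mem_bidegSections_iff] at hpq ⊢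
  refine fun a b => (theUnique_map (twist M _ a b) fun t => ?_).symm
  rw [isHarmonic_twist_iff]
  refine and_congr_right fun ht => ?_
  rw [← cls_twist_eq_cls_twist_iff ht.1 hs (weight p q a b)⁻¹ a b, hpq]

theorem proj_mem_cohBideg {p q : ℤ} {s : M → Fib n} (hs : s ∈ bidegSections n M p q) :
    X.proj s ∈ cohBideg p q := by
  by_cases h : X.harmProj s ∈ cocycles n M
  · exact mem_cohBideg_iff.2
      ⟨_, h, by simpa using X.isBihomogeneous_harmProj.map_mem hs, rfl⟩
  · rw [proj, cls, dif_neg h]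
    exact zero_mem _

/-! ## Bidegrees of the transferred operations -/

section Trees

variable {k : ℕ} {x : Fin k → M → Fib n} {p q : Fin k → ℤ}

theorem rootVal_node_mem_bidegSections (d : Dec) {l r : Tree (Fin k)}
    (hl : X.edgeVal x l ∈ bidegSections n M ((l.leaves.map p).sum - l.brks)
      ((l.leaves.map q).sum - (l.prods + l.brks)))
    (hr : X.edgeVal x r ∈ bidegSections n M ((r.leaves.map p).sum - r.brks)
      ((r.leaves.map q).sum - (r.prods + r.brks))) :
    X.rootVal x (.node d l r) ∈ bidegSections n M
      (((Tree.node d l r).leaves.map p).sum - (Tree.node d l r).brks)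
      (((Tree.node d l r).leaves.map q).sum -
        ((Tree.node d l r).prods + (Tree.node d l r).brks) + 1) := by
  have hpar := (isBihomogeneous_par.iterate r.prods).map_mem hl
  have h := Submodule.smul_mem _ ((-1 : ℂ) ^ (l.prods * r.prods))
    (X.binary_mem_bidegSections d hpar hr)
  rw [rootVal]
  convert h using 2 <;> cases d <;> simp [Tree.leaves, Tree.brks, Tree.prods] <;> ring

theorem edgeVal_mem_bidegSections (hx : ∀ i, x i ∈ bidegSections n M (p i) (q i))
    (T : Tree (Fin k)) (hT : T.deltas = 0) :
    X.edgeVal x T ∈ bidegSections n M ((T.leaves.map p).sum - T.brks)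
      ((T.leaves.map q).sum - (T.prods + T.brks)) := by
  induction T with
  | leaf i => simpa [Tree.leaves, Tree.brks, Tree.prods, edgeVal] using hx i
  | delta => simp [Tree.deltas] at hT
  | node d l r ihl ihr =>
    rw [Tree.deltas, Nat.add_eq_zero_iff] at hT
    have h := X.isBihomogeneous_htpy.map_mem
      (X.rootVal_node_mem_bidegSections d (ihl hT.1) (ihr hT.2))
    rwa [add_zero, add_neg_cancel_right] at h

theorem rootVal_mem_bidegSections (hx : ∀ i, x i ∈ bidegSections n M (p i) (q i))
    (T : Tree (Fin k)) (hT : T.deltas = 0) (hT' : 2 ≤ T.leaves.length) :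
    X.rootVal x T ∈ bidegSections n M ((T.leaves.map p).sum - T.brks)
      ((T.leaves.map q).sum - (T.prods + T.brks) + 1) := by
  cases T with
  | leaf => simp [Tree.leaves] at hT'
  | delta => simp [Tree.deltas] at hT
  | node d l r =>
    rw [Tree.deltas, Nat.add_eq_zero_iff] at hT
    exact X.rootVal_node_mem_bidegSections d (X.edgeVal_mem_bidegSections hx l hT.1)
      (X.edgeVal_mem_bidegSections hx r hT.2)

end Trees

theorem treeOp_mem_cohBideg {k : ℕ} (hk : 2 ≤ k) {T : Tree (Fin k)} (hT : T.deltas = 0)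
    (hp : T.leaves.Perm (List.finRange k)) {x : Fin k → H n M} {p q : Fin k → ℤ}
    (hx : ∀ i, x i ∈ cohBideg (p i) (q i)) :
    X.treeOp T x ∈ cohBideg ((∑ i, p i) + -(T.brks : ℤ)) ((∑ i, q i) + (-(k : ℤ) + 2)) := by
  have sum_leaves (f : Fin k → ℤ) : (T.leaves.map f).sum = ∑ i, f i := by
    rw [(hp.map f).sum_eq, Fin.sum_univ_def]
  have hcount : (T.prods : ℤ) + T.brks = k - 1 := by
    have := prods_add_brks hp
    lia
  refine Submodule.sum_mem _ fun ε _ => Submodule.smul_mem _ _ (X.proj_mem_cohBideg ?_)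
  have h := X.rootVal_mem_bidegSections
    (fun i => parityPart_mem_bidegSections (X.incl_mem_bidegSections (hx i)) (ε i)) T hT
    (by rwa [hp.length_eq, List.length_finRange])
  rw [sum_leaves, sum_leaves, hcount] at h
  convert h using 2 <;> ring

theorem hasBidegree_transferredOp {k : ℕ} (hk : 2 ≤ k) {c : BVcoDelta k 0} {ℓ : ℕ}
    (hℓ : HomogeneousBrackets c ℓ) :
    HasBidegree (X.transferredOp c) (-(ℓ : ℤ)) (-(k : ℤ) + 2) := by
  intro p q x hx
  refine Submodule.smul_mem _ _ (finsum_induction (· ∈ cohBideg _ _) (zero_mem _)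
    (fun _ _ => add_mem) fun T => ?_)
  by_cases hT : c.1 T = 0
  · rw [hT, zero_smul]
    exact zero_mem _
  · have hd : T.deltas = 0 := not_imp_comm.1 (c.2.2 T) hT
    have h := X.treeOp_mem_cohBideg hk hd (c.2.1.labels T hT) hx
    rw [hℓ T hT] at h
    exact Submodule.smul_mem _ _ h

end CalabiYau

end Manifold

end

end CYHy

theorem mainTheorem6 {n : ℕ} {M : Type*} [TopologicalSpace M] [T2Space M] [CompactSpace M]
    [ChartedSpace (CYHy.Cn n) M] [IsManifold 𝓘(ℂ, CYHy.Cn n) ω M]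
    [MeasurableSpace M] [BorelSpace M] (X : CYHy.CalabiYau n M)
    {k : ℕ} (hk : 2 ≤ k) (c : CYHy.BVcoDelta k 0) (ℓ : ℕ) (hℓ : CYHy.HomogeneousBrackets c ℓ)
    (hc : (CYHy.boundaries k).mkQ c ≠ 0) :
    ((CYHy.boundaries k).mkQ c ∈ CYHy.higherOps k →
      ((0 : ℤ) ≤ ℓ ∧ (ℓ : ℤ) < (k : ℤ) - 2) ∧
        CYHy.HasBidegree (X.transferredOp c) (-(ℓ : ℤ)) (-(k : ℤ) + 2)) ∧
    ((CYHy.boundaries k).mkQ c ∉ CYHy.higherOps k →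
      CYHy.HasBidegree (X.transferredOp c) (-(k : ℤ) + 2) (-(k : ℤ) + 2)) := by
  refine ⟨fun h => ⟨⟨Int.natCast_nonneg ℓ, CYHy.brackets_lt_of_mem_higherOps hk hℓ hc h⟩,
    X.hasBidegree_transferredOp hk hℓ⟩, fun h => ?_⟩
  have hb := X.hasBidegree_transferredOp hk hℓ
  rwa [CYHy.brackets_eq_of_notMem_higherOps hℓ h, neg_sub, sub_eq_neg_add] at hb
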